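/- All systems are finite-dimensional with fixed orthonormal bases; a state is a positive semi-definite operator of trace one, a channel is a completely positive trace-preserving linear map, $T_S$ is the transpose on the systems $S$ (in the fixed basis), and $X\ge Y$ means that $X-Y$ is positive semi-definite. The Choi operator of a linear map $\mathcal N_{C\to D}$ is $\Gamma^{\mathcal N}_{RD}=(\mathrm{id}_R\otimes\mathcal N)(|\Gamma\rangle\langle\Gamma|_{RC})$ with $R\simeq C$ and $|\Gamma\rangle_{RC}=\sum_i|i\rangle_R|i\rangle_C$. The diamond distance of channels is $\|\mathcal N-\mathcal M\|_\diamond=\sup_{\omega_{RC}}\|(\mathrm{id}_R\otimes\mathcal N)(\omega_{RC})-(\mathrm{id}_R\otimes\mathcal M)(\omega_{RC})\|_1$, the supremum being over all reference systems $R$ and all states $\omega_{RC}$, where $\|X\|_1=\operatorname{Tr}\sqrt{X^\dagger X}$. A bipartite channel $\mathcal P_{AB\to A'B'}$ (Alice holds $A,A'$, Bob holds $B,B'$) is C-PPT-P if $T_{B'}\circ\mathcal P\circ T_B$ is completely positive. Let $\mathcal N_{AB\to A'B'}$ be an arbitrary bipartite channel and $\rho_{\hat A\hat B}$ a state. Define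 the simulation error $$e_{\mathrm{PPT}}(\mathcal N,\rho)=\frac12\inf_{\mathcal P\in\text{C-PPT-P}}\big\|\mathcal N-\widetilde{\mathcal N}^{\mathcal P}\big\|_\diamond,\qquad \widetilde{\mathcal N}^{\mathcal P}(\omega_{AB})=\mathcal P(\omega_{AB}\otimes\rho_{\hat A\hat B}),$$ the infimum being over C-PPT-P channels $\mathcal P_{A\hat A\,B\hat B\to A'B'}$ (Alice's input is $A\hat A$, Bob's is $B\hat B$). **(1)** $e_{\mathrm{PPT}}(\mathcal N,\rho)$ is the value of the semi-definite program $$\inf_{\mu\ge0,\ Z_{ABA'B'}\ge0,\ P_{AB\hat A\hat BA'B'}\ge0}\ \mu$$ subject to $$\mu I_{AB}\ge\operatorname{Tr}_{A'B'}[Z_{ABA'B'}],\qquad T_{B\hat BB'}(P_{AB\hat A\hat BA'B'})\ge0,\qquad \operatorname{Tr}_{A'B'}[P_{AB\hat A\hat BA'B'}]=I_{AB\hat A\hat B},$$ $$Z_{ABA'B'}\ge\Gamma^{\mathcal N}_{ABA'B'}-\operatorname{Tr}_{\hat A\hat B}\big[T_{\hat A\hat B}(\rho_{\hat A\hat B})\,P_{AB\hat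 A\hat BA'B'}\big].$$ **(2)** The dual of this semi-definite program is $$\sup\ \operatorname{Tr}[\Gamma^{\mathcal N}_{ABA'B'}X^2_{ABA'B'}]-\operatorname{Tr}[W_{AB\hat A\hat B}]$$ over $X^1_{AB}\ge0$, $X^2_{ABA'B'}\ge0$, $X^3_{AB\hat A\hat BA'B'}\ge0$ and Hermitian $W_{AB\hat A\hat B}$, subject to $$\operatorname{Tr}[X^1_{AB}]\le1,\qquad X^2_{ABA'B'}\le X^1_{AB}\otimes I_{A'B'},$$ $$X^2_{ABA'B'}\otimes T_{\hat A\hat B}(\rho_{\hat A\hat B})+T_{B\hat BB'}(X^3_{AB\hat A\hat BA'B'})\le W_{AB\hat A\hat B}\otimes I_{A'B'}.$$ Here the dual of a program $\inf_{Y\ge0}\{\operatorname{Tr}[BY]:\Phi(Y)\ge A\}$, with $A,B$ Hermitian and $\Phi$ a Hermiticity-preserving linear map, is $\sup_{X\ge0}\{\operatorname{Tr}[AX]:\Phi^\dagger(X)\le B\}$, with $\Phi^\dagger$ the Hilbert–Schmidt adjoint. Precisely: writing the program in (1) in this standard form with $$Y=\operatorname{diag}(\mu,Z,P),\quad B=\operatorname{diag}(1,0,0),\quad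 A=\operatorname{diag}(0,\Gamma^{\mathcal N},0,I_{AB\hat A\hat B},-I_{AB\hat A\hat B}),$$ $$\Phi(Y)=\operatorname{diag}\big(\mu I_{AB}-\operatorname{Tr}_{A'B'}Z,\ Z+\operatorname{Tr}_{\hat A\hat B}[T_{\hat A\hat B}(\rho)P],\ T_{B\hat BB'}(P),\ \operatorname{Tr}_{A'B'}P,\ -\operatorname{Tr}_{A'B'}P\big)$$ ($\Phi$ of a general block operator depends only on its diagonal blocks), $A$ and $B$ are Hermitian, $\Phi$ preserves Hermiticity, the feasible points of the standard form attain exactly the same objective values as those of the program in (1), and the feasible points of its dual attain exactly the same objective values as those of the explicit dual program above. -/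

import Mathlib

open Matrix
open scoped Kronecker ComplexOrder

noncomputable section

namespace QSim

/-- A quantum state: positive semidefinite with unit trace. -/
def IsState {c : Type*} [Fintype c] (ρ : Matrix c c ℂ) : Prop :=
  ρ.PosSemidef ∧ ρ.trace = 1

/-- The trace norm `‖X‖₁ = Tr √(X† X)`. -/
def traceNorm {c : Type*} [Fintype c] [DecidableEq c] (X : Matrix c c ℂ) : ℝ :=
  (cfc Real.sqrt (Xᴴ * X)).trace.re

/-- The ampliation `id_R ⊗ N`, acting block by block. -/
def ampl (r : Type*) {c d : Type*} (N : Matrix c c ℂ →ₗ[ℂ] Matrix d d ℂ) :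
    Matrix (r × c) (r × c) ℂ →ₗ[ℂ] Matrix (r × d) (r × d) ℂ where
  toFun X := of fun p q => N (of fun i j => X (p.1, i) (q.1, j)) p.2 q.2
  map_add' X Y := by
    ext p q
    exact congrFun (congrFun (N.map_add (of fun i j => X (p.1, i) (q.1, j))
      (of fun i j => Y (p.1, i) (q.1, j))) p.2) q.2
  map_smul' z X := by
    ext p q
    exact congrFun (congrFun (N.map_smul z (of fun i j => X (p.1, i) (q.1, j))) p.2) q.2

/-- Complete positivity: `id_R ⊗ N` is positive for every finite-dimensional reference `R`. -/
def IsCP {c d : Type*} (N : Matrix c c ℂ →ₗ[ℂ] Matrix d d ℂ) : Prop :=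
  ∀ (n : ℕ) (X : Matrix (Fin n × c) (Fin n × c) ℂ), X.PosSemidef → (ampl (Fin n) N X).PosSemidef

/-- A quantum channel: a completely positive, trace-preserving linear map. -/
def IsChannel {c d : Type*} [Fintype c] [Fintype d]
    (N : Matrix c c ℂ →ₗ[ℂ] Matrix d d ℂ) : Prop :=
  IsCP N ∧ ∀ X, (N X).trace = X.trace

/-- The unnormalized maximally entangled vector `|Γ⟩ = ∑ i, |i⟩|i⟩`. -/
def gammaVec (c : Type*) [DecidableEq c] : c × c → ℂ := fun p => if p.1 = p.2 then 1 else 0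

/-- The Choi operator `(id_R ⊗ N)(|Γ⟩⟨Γ|)`, with `R ≃ C`. -/
def choi {c d : Type*} [DecidableEq c] (N : Matrix c c ℂ →ₗ[ℂ] Matrix d d ℂ) :
    Matrix (c × d) (c × d) ℂ :=
  ampl c N (vecMulVec (gammaVec c) (star (gammaVec c)))

/-- The diamond distance: the supremum, over all finite-dimensional reference systems `R` and all
states of `RC`, of the trace distance of the outputs. -/
def diamondDist {c d : Type*} [Fintype c] [Fintype d] [DecidableEq d]
    (N M : Matrix c c ℂ →ₗ[ℂ] Matrix d d ℂ) : ℝ :=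
  sSup {x : ℝ | ∃ (n : ℕ) (ρ : Matrix (Fin n × c) (Fin n × c) ℂ), IsState ρ ∧
    x = traceNorm (ampl (Fin n) N ρ - ampl (Fin n) M ρ)}

/-- Partial transpose on the second tensor factor. -/
def transposeRight (a b : Type*) :
    Matrix (a × b) (a × b) ℂ →ₗ[ℂ] Matrix (a × b) (a × b) ℂ where
  toFun X := of fun p q => X (p.1, q.2) (q.1, p.2)
  map_add' _ _ := by ext; simp
  map_smul' _ _ := by ext; simp

/-- A bipartite map `P : AB → A'B'` is a C-PPT-P channel if it is a channel and
`T_{B'} ∘ P ∘ T_B` is completely positive. -/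
def IsCPPTP {a b a' b' : Type*} [Fintype a] [Fintype b] [Fintype a'] [Fintype b']
    (P : Matrix (a × b) (a × b) ℂ →ₗ[ℂ] Matrix (a' × b') (a' × b') ℂ) : Prop :=
  IsChannel P ∧ IsCP (transposeRight a' b' ∘ₗ P ∘ₗ transposeRight a b)

/-- The operator `ω_{AB} ⊗ ρ_{ÂB̂}`, its systems ordered as `(A Â)(B B̂)` (Alice's first). -/
def attach {a b ah bh : Type*} (ρ : Matrix (ah × bh) (ah × bh) ℂ) :
    Matrix (a × b) (a × b) ℂ →ₗ[ℂ] Matrix ((a × ah) × (b × bh)) ((a × ah) × (b × bh)) ℂ where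
  toFun ω := (ω ⊗ₖ ρ).submatrix
    (fun p => ((p.1.1, p.2.1), (p.1.2, p.2.2))) (fun p => ((p.1.1, p.2.1), (p.1.2, p.2.2)))
  map_add' _ _ := by ext; simp [add_mul]
  map_smul' _ _ := by ext; simp [mul_assoc]

/-- The simulation `ω_{AB} ↦ P(ω_{AB} ⊗ ρ_{ÂB̂})`; Alice's input of `P` is `AÂ`, Bob's is `BB̂`. -/
def simulation {a b ah bh a' b' : Type*} (ρ : Matrix (ah × bh) (ah × bh) ℂ)
    (P : Matrix ((a × ah) × (b × bh)) ((a × ah) × (b × bh)) ℂ →ₗ[ℂ]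
      Matrix (a' × b') (a' × b') ℂ) :
    Matrix (a × b) (a × b) ℂ →ₗ[ℂ] Matrix (a' × b') (a' × b') ℂ :=
  P ∘ₗ attach ρ

/-- Partial trace over the second factor. -/
def traceRight (m n : Type*) [Fintype n] : Matrix (m × n) (m × n) ℂ →ₗ[ℂ] Matrix m m ℂ where
  toFun X := of fun i j => ∑ k, X (i, k) (j, k)
  map_add' _ _ := by ext; simp [Finset.sum_add_distrib]
  map_smul' _ _ := by ext; simp [Finset.mul_sum]

/-- Partial trace over the middle factor. -/
def traceMid (m k n : Type*) [Fintype k] :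
    Matrix ((m × k) × n) ((m × k) × n) ℂ →ₗ[ℂ] Matrix (m × n) (m × n) ℂ where
  toFun X := of fun p q => ∑ x, X ((p.1, x), p.2) ((q.1, x), q.2)
  map_add' _ _ := by ext; simp [Finset.sum_add_distrib]
  map_smul' _ _ := by ext; simp [Finset.mul_sum]

/-- The map `P ↦ Tr_{ÂB̂}[T_{ÂB̂}(ρ_{ÂB̂}) P]`. -/
def contract {k : Type*} [Fintype k] (m n : Type*) [Fintype m] [Fintype n]
    [DecidableEq m] [DecidableEq n] (ρ : Matrix k k ℂ) :
    Matrix ((m × k) × n) ((m × k) × n) ℂ →ₗ[ℂ] Matrix (m × n) (m × n) ℂ :=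
  traceMid m k n ∘ₗ LinearMap.mulLeft ℂ (((1 : Matrix m m ℂ) ⊗ₖ ρᵀ) ⊗ₖ (1 : Matrix n n ℂ))

/-- The operator `X_{mn} ⊗ σ_k`, its systems ordered as `(m k) n`. -/
def insertMid {m k n : Type*} (X : Matrix (m × n) (m × n) ℂ) (σ : Matrix k k ℂ) :
    Matrix ((m × k) × n) ((m × k) × n) ℂ :=
  (X ⊗ₖ σ).submatrix (fun p => ((p.1.1, p.2), p.1.2)) (fun p => ((p.1.1, p.2), p.1.2))

/-- The partial transpose `T_{B B̂ B'}` on operators of the systems `(AB)(ÂB̂)(A'B')`. -/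
def transposeBob (a b ah bh a' b' : Type*) :
    Matrix (((a × b) × (ah × bh)) × (a' × b')) (((a × b) × (ah × bh)) × (a' × b')) ℂ →ₗ[ℂ]
      Matrix (((a × b) × (ah × bh)) × (a' × b')) (((a × b) × (ah × bh)) × (a' × b')) ℂ where
  toFun X := of fun p q =>
    X (((p.1.1.1, q.1.1.2), (p.1.2.1, q.1.2.2)), (p.2.1, q.2.2))
      (((q.1.1.1, p.1.1.2), (q.1.2.1, p.1.2.2)), (q.2.1, p.2.2))
  map_add' _ _ := by ext; simp
  map_smul' _ _ := by ext; simp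

/-! ### Semidefinite programs in standard form -/

/-- Data of the semidefinite program `inf_{Y ≥ 0} {Tr[BY] : Φ(Y) ≥ A}`. -/
structure SDP (n m : Type*) where
  A : Matrix m m ℂ
  B : Matrix n n ℂ
  Φ : Matrix n n ℂ →ₗ[ℂ] Matrix m m ℂ

namespace SDP

variable {n m : Type*} [Fintype n] [Fintype m]

/-- `A` and `B` are Hermitian and `Φ` preserves Hermiticity. -/
def IsHermitian {n m : Type*} (S : SDP n m) : Prop :=
  S.A.IsHermitian ∧ S.B.IsHermitian ∧ ∀ Y : Matrix n n ℂ, Y.IsHermitian → (S.Φ Y).IsHermitian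

open Classical in
/-- The Hilbert-Schmidt adjoint of a linear map on matrices. -/
def adjoint (Φ : Matrix n n ℂ →ₗ[ℂ] Matrix m m ℂ) (X : Matrix m m ℂ) : Matrix n n ℂ :=
  of fun i j => ((Φ (Matrix.single i j 1))ᴴ * X).trace

/-- The defining property of the adjoint. -/
theorem trace_adjoint (Φ : Matrix n n ℂ →ₗ[ℂ] Matrix m m ℂ) (X : Matrix m m ℂ)
    (Y : Matrix n n ℂ) : (Yᴴ * adjoint Φ X).trace = ((Φ Y)ᴴ * X).trace := by
  classical
  have key : ∀ Y : Matrix n n ℂ, Φ Y = ∑ i, ∑ j, Y i j • Φ (Matrix.single i j 1) := by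
    intro Y
    conv_lhs => rw [Matrix.matrix_eq_sum_single Y]
    simp only [map_sum]
    refine Finset.sum_congr rfl fun i _ => Finset.sum_congr rfl fun j _ => ?_
    rw [← map_smul, Matrix.smul_single, smul_eq_mul, mul_one]
  rw [key Y]
  simp only [conjTranspose_sum, conjTranspose_smul, Finset.sum_mul, trace_sum, smul_mul_assoc,
    trace_smul]
  simp only [Matrix.trace, Matrix.diag, Matrix.mul_apply, adjoint, of_apply, conjTranspose_apply,
    smul_eq_mul]
  rw [Finset.sum_comm]

/-- Objective values of the feasible points of `inf_{Y ≥ 0} {Tr[BY] : Φ(Y) ≥ A}`. -/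
def primalValues (S : SDP n m) : Set ℝ :=
  {v | ∃ Y : Matrix n n ℂ, Y.PosSemidef ∧ (S.Φ Y - S.A).PosSemidef ∧ v = (S.B * Y).trace.re}

/-- Objective values of the feasible points of the dual program
`sup_{X ≥ 0} {Tr[AX] : Φ†(X) ≤ B}`. -/
def dualValues (S : SDP n m) : Set ℝ :=
  {v | ∃ X : Matrix m m ℂ, X.PosSemidef ∧ (S.B - adjoint S.Φ X).PosSemidef ∧
    v = (S.A * X).trace.re}

end SDP

/-! ### The simulation error and its semidefinite programs -/

section Programs

variable {a b ah bh a' b' : Type*} [Fintype a] [Fintype b] [Fintype ah] [Fintype bh]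
  [Fintype a'] [Fintype b'] [DecidableEq a] [DecidableEq b] [DecidableEq ah] [DecidableEq bh]
  [DecidableEq a'] [DecidableEq b']

/-- The simulation error `e_PPT(N, ρ)` under C-PPT-P channels, in normalized diamond distance. -/
def errPPT (N : Matrix (a × b) (a × b) ℂ →ₗ[ℂ] Matrix (a' × b') (a' × b') ℂ)
    (ρ : Matrix (ah × bh) (ah × bh) ℂ) : ℝ :=
  (1 / 2) * sInf {x : ℝ | ∃ P : Matrix ((a × ah) × (b × bh)) ((a × ah) × (b × bh)) ℂ →ₗ[ℂ]
    Matrix (a' × b') (a' × b') ℂ, IsCPPTP P ∧ x = diamondDist N (simulation ρ P)}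

/-- Objective values `μ` of the feasible points of the primal program. -/
def simPrimalValues (N : Matrix (a × b) (a × b) ℂ →ₗ[ℂ] Matrix (a' × b') (a' × b') ℂ)
    (ρ : Matrix (ah × bh) (ah × bh) ℂ) : Set ℝ :=
  {μ | ∃ (Z : Matrix ((a × b) × (a' × b')) ((a × b) × (a' × b')) ℂ)
      (P : Matrix (((a × b) × (ah × bh)) × (a' × b')) (((a × b) × (ah × bh)) × (a' × b')) ℂ),
    0 ≤ μ ∧ Z.PosSemidef ∧ P.PosSemidef ∧
    ((μ : ℂ) • (1 : Matrix (a × b) (a × b) ℂ) - traceRight (a × b) (a' × b') Z).PosSemidef ∧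
    (transposeBob a b ah bh a' b' P).PosSemidef ∧
    traceRight ((a × b) × (ah × bh)) (a' × b') P = 1 ∧
    (Z - (choi N - contract (a × b) (a' × b') ρ P)).PosSemidef}

/-- Objective values of the feasible points of the explicit dual program. -/
def simDualValues (N : Matrix (a × b) (a × b) ℂ →ₗ[ℂ] Matrix (a' × b') (a' × b') ℂ)
    (ρ : Matrix (ah × bh) (ah × bh) ℂ) : Set ℝ :=
  {v | ∃ (X₁ : Matrix (a × b) (a × b) ℂ)
      (X₂ : Matrix ((a × b) × (a' × b')) ((a × b) × (a' × b')) ℂ)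
      (X₃ : Matrix (((a × b) × (ah × bh)) × (a' × b')) (((a × b) × (ah × bh)) × (a' × b')) ℂ)
      (W : Matrix ((a × b) × (ah × bh)) ((a × b) × (ah × bh)) ℂ),
    X₁.PosSemidef ∧ X₂.PosSemidef ∧ X₃.PosSemidef ∧ W.IsHermitian ∧
    X₁.trace.re ≤ 1 ∧
    (X₁ ⊗ₖ (1 : Matrix (a' × b') (a' × b') ℂ) - X₂).PosSemidef ∧
    (W ⊗ₖ (1 : Matrix (a' × b') (a' × b') ℂ)
      - (insertMid X₂ ρᵀ + transposeBob a b ah bh a' b' X₃)).PosSemidef ∧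
    v = (choi N * X₂).trace.re - W.trace.re}

/-- Block-diagonal matrix with the two given blocks. -/
def diag₂ {p q : Type*} (X : Matrix p p ℂ) (Y : Matrix q q ℂ) : Matrix (p ⊕ q) (p ⊕ q) ℂ :=
  fromBlocks X 0 0 Y

/-- The primal program in standard form. The variable is `Y = diag(μ, Z, P)`, and
`B = diag(1, 0, 0)`, `A = diag(0, Γ^N, 0, I, -I)`,
`Φ(Y) = diag(μ I - Tr_{A'B'} Z, Z + Tr_{ÂB̂}[T(ρ) P], T_{BB̂B'} P, Tr_{A'B'} P, -Tr_{A'B'} P)`;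
the equality constraint on `P` is written as two inequalities. -/
def simSDP (N : Matrix (a × b) (a × b) ℂ →ₗ[ℂ] Matrix (a' × b') (a' × b') ℂ)
    (ρ : Matrix (ah × bh) (ah × bh) ℂ) :
    SDP (Unit ⊕ (((a × b) × (a' × b')) ⊕ (((a × b) × (ah × bh)) × (a' × b'))))
      ((a × b) ⊕ (((a × b) × (a' × b')) ⊕ ((((a × b) × (ah × bh)) × (a' × b')) ⊕
        (((a × b) × (ah × bh)) ⊕ ((a × b) × (ah × bh)))))) where
  A := diag₂ 0 (diag₂ (choi N) (diag₂ 0 (diag₂ 1 (-1))))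
  B := diag₂ 1 (diag₂ 0 0)
  Φ :=
    { toFun := fun Y =>
        let μ : ℂ := Y (Sum.inl ()) (Sum.inl ())
        let Z := Y.toBlocks₂₂.toBlocks₁₁
        let P := Y.toBlocks₂₂.toBlocks₂₂
        diag₂ (μ • 1 - traceRight (a × b) (a' × b') Z)
          (diag₂ (Z + contract (a × b) (a' × b') ρ P)
            (diag₂ (transposeBob a b ah bh a' b' P)
              (diag₂ (traceRight ((a × b) × (ah × bh)) (a' × b') P)
                (-traceRight ((a × b) × (ah × bh)) (a' × b') P))))
      map_add' := by
        intro X Y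
        have h₁ : (X + Y).toBlocks₂₂.toBlocks₁₁
            = X.toBlocks₂₂.toBlocks₁₁ + Y.toBlocks₂₂.toBlocks₁₁ := rfl
        have h₂ : (X + Y).toBlocks₂₂.toBlocks₂₂
            = X.toBlocks₂₂.toBlocks₂₂ + Y.toBlocks₂₂.toBlocks₂₂ := rfl
        simp only [diag₂, h₁, h₂, map_add, Matrix.add_apply, fromBlocks_add, add_zero, add_smul]
        congr 1
        · abel
        · congr 1
          · abel
          · congr 2
            abel
      map_smul' := by
        intro z X
        have h₁ : (z • X).toBlocks₂₂.toBlocks₁₁ = z • X.toBlocks₂₂.toBlocks₁₁ := rfl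
        have h₂ : (z • X).toBlocks₂₂.toBlocks₂₂ = z • X.toBlocks₂₂.toBlocks₂₂ := rfl
        simp only [diag₂, h₁, h₂, map_smul, Matrix.smul_apply, fromBlocks_smul, smul_zero,
          smul_sub, smul_add, smul_neg, smul_smul, smul_eq_mul, RingHom.id_apply] }

end Programs

end QSim

end

/-!
The difference of two channels is determined by the difference `J` of their Choi operators. For a
traceless Hermitian operator, half the trace norm is the least trace of a majorant, that is, of a
positive semidefinite operator above it: the positive part attains the minimum. A pure state on
`R C` with marginal `σ = Sᴴ S` maps `J` to `(S ⊗ 1) J (S ⊗ 1)ᴴ`; for invertible `S` this conjugation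
is a bijection between majorants, so half the trace norm becomes the minimum of `Tr[σ Tr_D Z]` over
majorants `Z` of `J`. Maximising over `σ` and exchanging the maximum with the minimum (Sion) leaves
the least `μ` with `Tr_D Z ≤ μ 1`, which is half the diamond distance.

C-PPT-P channels correspond to their Choi operators, and the Choi operator of a simulation is the
contraction of that of `P` with `ρᵀ`. This gives the primal program. For the dual one, the adjoint
of `Φ` is computed block by block; the two multipliers of the equality constraint `Tr_{A'B'} P = 1`
only enter through their difference `W`, and every Hermitian `W` is such a difference `W⁺ - W⁻`.
-/

noncomputable section

namespace QSim

open scoped MatrixOrder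

section Positivity

variable {c : Type*}

theorem eq_of_posSemidef_sub {A B : Matrix c c ℂ} (h₁ : (A - B).PosSemidef)
    (h₂ : (-A - -B).PosSemidef) : A = B := by
  rw [neg_sub_neg] at h₂
  exact le_antisymm (le_iff.2 h₂) (le_iff.2 h₁)

variable [Fintype c]

theorem trace_mul_nonneg {A B : Matrix c c ℂ} (hA : A.PosSemidef) (hB : B.PosSemidef) :
    0 ≤ (A * B).trace := by
  classical
  obtain ⟨C, rfl⟩ := CStarAlgebra.nonneg_iff_eq_star_mul_self.mp hA.nonneg
  rw [star_eq_conjTranspose, trace_mul_cycle, trace_mul_cycle]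
  exact (hB.mul_mul_conjTranspose_same C).trace_nonneg

theorem posSemidef_trace_smul_one_sub [DecidableEq c] {A : Matrix c c ℂ} (hA : A.PosSemidef) :
    (A.trace • (1 : Matrix c c ℂ) - A).PosSemidef := by
  have htr : A.trace = ((∑ i, hA.1.eigenvalues i : ℝ) : ℂ) := by
    simp [hA.1.trace_eq_sum_eigenvalues]
  have hle : A ≤ algebraMap ℝ _ (∑ i, hA.1.eigenvalues i) := by
    refine le_algebraMap_of_spectrum_le (fun x hx => ?_) hA.1
    rw [hA.1.spectrum_real_eq_range_eigenvalues] at hx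
    obtain ⟨i, rfl⟩ := hx
    exact Finset.single_le_sum (fun j _ => hA.eigenvalues_nonneg j) (Finset.mem_univ i)
  rw [htr, Complex.coe_smul, ← Algebra.algebraMap_eq_smul_one]
  exact le_iff.1 hle

end Positivity

section Majorants

variable {c : Type*}

/-- The positive semidefinite matrices dominating `J`, that is, the operators `Z` with `Z ≥ 0` and
`Z ≥ J` of the semidefinite program for the diamond distance. -/
def psdMajorants (J : Matrix c c ℂ) : Set (Matrix c c ℂ) :=
  {Z | Z.PosSemidef ∧ (Z - J).PosSemidef}

theorem isHermitian_of_mem_psdMajorants {J Z : Matrix c c ℂ} (hZ : Z ∈ psdMajorants J) :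
    J.IsHermitian := by
  simpa using hZ.1.1.sub hZ.2.1

theorem convex_psdMajorants (J : Matrix c c ℂ) : Convex ℝ (psdMajorants J) := by
  rintro Z ⟨hZ, hZJ⟩ W ⟨hW, hWJ⟩ s t hs ht hst
  have hJ : s • Z + t • W - J = s • (Z - J) + t • (W - J) := by
    rw [smul_sub, smul_sub, sub_add_sub_comm, ← add_smul, hst, one_smul]
  exact ⟨(hZ.smul hs).add (hW.smul ht), hJ ▸ (hZJ.smul hs).add (hWJ.smul ht)⟩

variable [Fintype c]

theorem conj_mem_psdMajorants {d : Type*} [Finite d] {J Z : Matrix c c ℂ} (hZ : Z ∈ psdMajorants J)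
    (S : Matrix d c ℂ) : S * Z * Sᴴ ∈ psdMajorants (S * J * Sᴴ) := by
  refine ⟨hZ.1.mul_mul_conjTranspose_same S, ?_⟩
  rw [← Matrix.sub_mul, ← Matrix.mul_sub]
  exact hZ.2.mul_mul_conjTranspose_same S

variable [DecidableEq c]

theorem posPart_mem_psdMajorants {J : Matrix c c ℂ} (hJ : J.IsHermitian) :
    J⁺ ∈ psdMajorants J :=
  ⟨(CFC.posPart_nonneg J).posSemidef, le_iff.1 (CFC.le_posPart hJ)⟩

theorem exists_spectral_projection_mul_eq_posPart {J : Matrix c c ℂ} (hJ : J.IsHermitian) :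
    ∃ E : Matrix c c ℂ, E.PosSemidef ∧ (1 - E).PosSemidef ∧ E * J = J⁺ := by
  have hJ' : IsSelfAdjoint J := hJ
  have hcont (f : ℝ → ℝ) : ContinuousOn f (spectrum ℝ J) :=
    (Matrix.finite_real_spectrum (A := J)).continuousOn f
  let χ : ℝ → ℝ := Set.indicator (Set.Ici 0) 1
  refine ⟨cfc χ J, ?_, ?_, ?_⟩
  · exact (cfc_nonneg fun x _ => Set.indicator_nonneg (by simp) x).posSemidef
  · rw [← cfc_one ℝ J, ← cfc_sub _ _ J (hcont _) (hcont _)]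
    refine (cfc_nonneg fun x _ => sub_nonneg.2 ?_).posSemidef
    exact Set.indicator_le_self' (by simp) x
  · nth_rewrite 2 [← cfc_id' ℝ J]
    rw [← cfc_mul _ _ J (hcont _) (hcont _), CFC.posPart_def, cfcₙ_eq_cfc]
    refine cfc_congr fun x _ => ?_
    rcases le_or_gt 0 x with hx | hx
    · simp [χ, hx]
    · simp [χ, hx.not_ge, hx.le]

theorem re_trace_posPart_le {J Z : Matrix c c ℂ} (hZ : Z ∈ psdMajorants J) :
    J⁺.trace.re ≤ Z.trace.re := by
  obtain ⟨E, hE, hE', hEJ⟩ :=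
    exists_spectral_projection_mul_eq_posPart (isHermitian_of_mem_psdMajorants hZ)
  have h₁ : 0 ≤ (E * Z).trace - J⁺.trace := by
    simpa [mul_sub, hEJ] using trace_mul_nonneg hE hZ.2
  have h₂ : 0 ≤ Z.trace - (E * Z).trace := by
    simpa [sub_mul] using trace_mul_nonneg hE' hZ.1
  exact (Complex.le_def.1 ((sub_nonneg.1 h₁).trans (sub_nonneg.1 h₂))).1

end Majorants

section TraceNorm

variable {c : Type*} [Fintype c] [DecidableEq c]

theorem traceNorm_eq_trace_abs (X : Matrix c c ℂ) : traceNorm X = (CFC.abs X).trace.re := by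
  rw [traceNorm, CFC.abs, CFC.sqrt_eq_real_sqrt _ (star_mul_self_nonneg X), cfcₙ_eq_cfc,
    star_eq_conjTranspose]

theorem traceNorm_nonneg (X : Matrix c c ℂ) : 0 ≤ traceNorm X := by
  rw [traceNorm_eq_trace_abs]
  exact (Complex.nonneg_iff.1 (CFC.abs_nonneg X).posSemidef.trace_nonneg).1

theorem traceNorm_eq_two_mul_trace_posPart {X : Matrix c c ℂ} (hX : X.IsHermitian)
    (htr : X.trace = 0) : traceNorm X = 2 * X⁺.trace.re := by
  have hneg : X⁺.trace = X⁻.trace := by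
    rw [← sub_eq_zero, ← trace_sub, CFC.posPart_sub_negPart X hX, htr]
  rw [traceNorm_eq_trace_abs, ← CFC.posPart_add_negPart X hX, trace_add, ← hneg, Complex.add_re,
    two_mul]

theorem traceNorm_le_two_mul_trace {X Z : Matrix c c ℂ} (htr : X.trace = 0)
    (hZ : Z ∈ psdMajorants X) : traceNorm X ≤ 2 * Z.trace.re := by
  rw [traceNorm_eq_two_mul_trace_posPart (isHermitian_of_mem_psdMajorants hZ) htr]
  exact mul_le_mul_of_nonneg_left (re_trace_posPart_le hZ) zero_le_two

end TraceNorm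

section States

variable {c : Type*} [Fintype c]

theorem IsState.nonempty {σ : Matrix c c ℂ} (hσ : IsState σ) : Nonempty c := by
  by_contra h
  rw [not_nonempty_iff] at h
  exact zero_ne_one ((trace_eq_zero_of_isEmpty σ).symm.trans hσ.2)

theorem convex_isState : Convex ℝ {σ : Matrix c c ℂ | IsState σ} := by
  rintro σ ⟨hσ, hσ₁⟩ τ ⟨hτ, hτ₁⟩ s t hs ht hst
  refine ⟨(hσ.smul hs).add (hτ.smul ht), ?_⟩
  rw [trace_add, trace_smul, trace_smul, hσ₁, hτ₁, ← add_smul, hst, one_smul]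

theorem isState_inv_card_smul_one (c : Type*) [Fintype c] [DecidableEq c] [Nonempty c] :
    IsState ((Fintype.card c : ℝ)⁻¹ • (1 : Matrix c c ℂ)) := by
  refine ⟨PosSemidef.one.smul (by positivity), ?_⟩
  rw [trace_smul, trace_one, Complex.real_smul, Complex.ofReal_inv, Complex.ofReal_natCast]
  exact inv_mul_cancel₀ (by exact_mod_cast Fintype.card_ne_zero)

theorem exists_posDef_isState [Nonempty c] : ∃ τ : Matrix c c ℂ, τ.PosDef ∧ IsState τ := by
  classical
  exact ⟨_, PosDef.one.smul (inv_pos.2 (by exact_mod_cast Fintype.card_pos)),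
    isState_inv_card_smul_one c⟩

open scoped Matrix.Norms.L2Operator in
theorem isCompact_isState : IsCompact {σ : Matrix c c ℂ | IsState σ} := by
  classical
  have hclosed : IsClosed {σ : Matrix c c ℂ | IsState σ} := by
    have hpsd : IsClosed {σ : Matrix c c ℂ | σ.PosSemidef} := by
      simpa only [nonneg_iff_posSemidef] using CStarAlgebra.isClosed_nonneg (A := Matrix c c ℂ)
    exact hpsd.inter (isClosed_eq (by fun_prop) continuous_const)
  have : ProperSpace (Matrix c c ℂ) := FiniteDimensional.proper ℂ _
  refine Metric.isCompact_of_isClosed_isBounded hclosed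
    (Metric.isBounded_closedBall (x := 0) (r := 1) |>.subset fun σ hσ => ?_)
  rw [mem_closedBall_zero_iff, CStarAlgebra.norm_le_one_iff_of_nonneg σ hσ.1.nonneg]
  have hle := posSemidef_trace_smul_one_sub hσ.1
  rw [hσ.2, one_smul] at hle
  exact le_iff.2 hle

theorem posSemidef_of_trace_mul_state_nonneg {A : Matrix c c ℂ} (hA : A.IsHermitian)
    (h : ∀ σ : Matrix c c ℂ, IsState σ → 0 ≤ (σ * A).trace.re) : A.PosSemidef := by
  classical
  rw [hA.posSemidef_iff_eigenvalues_nonneg]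
  intro i
  set v : c → ℂ := ⇑(hA.eigenvectorBasis i)
  have hv : v ⬝ᵥ star v = 1 := by
    have := EuclideanSpace.inner_eq_star_dotProduct (hA.eigenvectorBasis i) (hA.eigenvectorBasis i)
    rw [inner_self_eq_norm_sq_to_K, hA.eigenvectorBasis.norm_eq_one] at this
    simpa using this.symm
  have hvA := h (vecMulVec v (star v))
    ⟨posSemidef_vecMulVec_self_star v, by rw [trace_vecMulVec, hv]⟩
  rw [vecMulVec_mul, trace_vecMulVec, dotProduct_comm, ← dotProduct_mulVec] at hvA
  exact hvA.trans_eq (hA.eigenvalues_eq i).symm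

end States

section Minimax

variable {c : Type*} [Fintype c] [DecidableEq c]

/-- Sion's theorem exchanges the quantifiers over the compact convex set of states and over `𝒜`. -/
theorem exists_mem_posSemidef_smul_one_sub {𝒜 : Set (Matrix c c ℂ)} (hne : 𝒜.Nonempty)
    (hconv : Convex ℝ 𝒜) (hherm : ∀ A ∈ 𝒜, A.IsHermitian) {μ : ℝ}
    (hμ : ∀ σ : Matrix c c ℂ, IsState σ → ∃ A ∈ 𝒜, (σ * A).trace.re < μ) :
    ∃ A ∈ 𝒜, ((μ : ℂ) • (1 : Matrix c c ℂ) - A).PosSemidef := by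
  rcases isEmpty_or_nonempty c with hc | hc
  · obtain ⟨A, hA⟩ := hne
    refine ⟨A, hA, ?_⟩
    rw [Subsingleton.elim (_ - A) 0]
    exact PosSemidef.zero
  let f : Matrix c c ℂ →ₗ[ℝ] Matrix c c ℂ →ₗ[ℝ] ℝ :=
    -(LinearMap.mul ℝ (Matrix c c ℂ)).compr₂ (Complex.reLm ∘ₗ traceLinearMap c ℝ ℂ)
  have hf (σ A : Matrix c c ℂ) : -μ < f σ A ↔ (σ * A).trace.re < μ := neg_lt_neg_iff
  have hf_left (A : Matrix c c ℂ) : Continuous fun σ => f σ A :=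
    LinearMap.continuous_of_finiteDimensional (f.flip A)
  have hf_right (σ : Matrix c c ℂ) : Continuous fun A => f σ A :=
    LinearMap.continuous_of_finiteDimensional (f σ)
  obtain ⟨s, hs⟩ := isCompact_isState.elim_finite_subcover
    (fun A : 𝒜 => {σ : Matrix c c ℂ | -μ < f σ A})
    (fun A => isOpen_lt continuous_const (hf_left A)) fun σ hσ => by
      obtain ⟨A, hA, hlt⟩ := hμ σ hσ
      exact Set.mem_iUnion.2 ⟨⟨A, hA⟩, (hf σ A).2 hlt⟩
  obtain ⟨τ, -, hτ⟩ := exists_posDef_isState (c := c)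
  obtain ⟨A, hA, hlt⟩ := Sion.exists_lt_iInf_of_lt_iInf_of_finite
    (X := {σ : Matrix c c ℂ | IsState σ}) (Y := 𝒜) (f := fun σ A => f σ A) ⟨τ, hτ⟩
    isCompact_isState
    (fun A _ => (hf_left A).continuousOn.lowerSemicontinuousOn)
    (fun A _ => ((f.flip A).convexOn convex_isState).quasiconvexOn) hconv
    (fun σ _ => (hf_right σ).continuousOn.upperSemicontinuousOn)
    (fun σ _ => ((f σ).concaveOn hconv).quasiconcaveOn) convex_isState
    (s := Subtype.val '' (s : Set 𝒜)) (s.finite_toSet.image _)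
    (by rintro _ ⟨A, -, rfl⟩; exact A.2) (t := -μ) fun σ hσ => by
      obtain ⟨A, hAs, hlt⟩ := Set.mem_iUnion₂.1 (hs hσ)
      exact ⟨A, ⟨A, hAs, rfl⟩, hlt⟩
  refine ⟨A, hA, posSemidef_of_trace_mul_state_nonneg ?_ fun σ hσ => ?_⟩
  · exact (isHermitian_one.smul (Complex.conj_ofReal μ)).sub (hherm A hA)
  · have hσA := (hf σ A).1 (hlt σ hσ)
    rw [mul_sub, trace_sub, mul_smul_comm, mul_one, trace_smul, hσ.2, smul_eq_mul, mul_one,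
      Complex.sub_re, Complex.ofReal_re]
    linarith

end Minimax

section PartialTrace

variable {m n : Type*} [Fintype n]

theorem traceRight_apply (Z : Matrix (m × n) (m × n) ℂ) (i j : m) :
    traceRight m n Z i j = ∑ k, Z (i, k) (j, k) := rfl

theorem traceRight_conjTranspose (Z : Matrix (m × n) (m × n) ℂ) :
    traceRight m n Zᴴ = (traceRight m n Z)ᴴ := by
  ext i j
  simp [traceRight_apply]

theorem isHermitian_traceRight {Z : Matrix (m × n) (m × n) ℂ} (hZ : Z.IsHermitian) :
    (traceRight m n Z).IsHermitian := by
  rw [IsHermitian, ← traceRight_conjTranspose, hZ.eq]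

theorem posSemidef_traceRight {Z : Matrix (m × n) (m × n) ℂ} (hZ : Z.PosSemidef) :
    (traceRight m n Z).PosSemidef := by
  have hsum : traceRight m n Z = ∑ k, Z.submatrix (fun i => (i, k)) (fun i => (i, k)) := by
    ext i j
    simp [traceRight_apply, Matrix.sum_apply]
  rw [hsum]
  exact posSemidef_sum _ fun k _ => hZ.submatrix _

theorem trace_traceRight_mul [Fintype m] [DecidableEq n] (Z : Matrix (m × n) (m × n) ℂ)
    (A : Matrix m m ℂ) :
    (traceRight m n Z * A).trace = (Z * (A ⊗ₖ (1 : Matrix n n ℂ))).trace := by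
  simp only [trace, diag_apply, mul_apply, traceRight_apply, kroneckerMap_apply, one_apply,
    Fintype.sum_prod_type, mul_ite, mul_one, mul_zero, Finset.sum_ite_eq', Finset.mem_univ,
    if_true, Finset.sum_mul]
  exact Finset.sum_congr rfl fun _ _ => Finset.sum_comm

theorem trace_traceRight [Fintype m] (Z : Matrix (m × n) (m × n) ℂ) :
    (traceRight m n Z).trace = Z.trace := by
  simp [trace, traceRight_apply, Fintype.sum_prod_type]

theorem trace_conj_kronecker_one [Fintype m] [DecidableEq n] {l : Type*} [Fintype l]
    (S : Matrix l m ℂ) (Z : Matrix (m × n) (m × n) ℂ) :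
    ((S ⊗ₖ (1 : Matrix n n ℂ)) * Z * (S ⊗ₖ (1 : Matrix n n ℂ))ᴴ).trace
      = (Sᴴ * S * traceRight m n Z).trace := by
  rw [trace_mul_cycle, trace_mul_comm _ Z, trace_mul_comm _ (traceRight m n Z),
    trace_traceRight_mul, conjTranspose_kronecker, conjTranspose_one,
    ← mul_kronecker_mul, Matrix.one_mul]

end PartialTrace

section Ampliation

variable {r c d : Type*}

theorem trace_ampl [Fintype r] [Fintype d] (N : Matrix c c ℂ →ₗ[ℂ] Matrix d d ℂ)
    (X : Matrix (r × c) (r × c) ℂ) :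
    (ampl r N X).trace = ∑ k, (N (X.submatrix (Prod.mk k) (Prod.mk k))).trace :=
  Fintype.sum_prod_type _

end Ampliation

section Choi

variable {c d : Type*} [DecidableEq c]

theorem choi_apply (N : Matrix c c ℂ →ₗ[ℂ] Matrix d d ℂ) (p q : c × d) :
    choi N p q = N (single p.1 q.1 1) p.2 q.2 := by
  have hblock : (of fun i j => vecMulVec (gammaVec c) (star (gammaVec c)) (p.1, i) (q.1, j))
      = single p.1 q.1 (1 : ℂ) := by
    ext i j
    simp only [vecMulVec_apply, gammaVec, single_apply, of_apply, Pi.star_apply]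
    split_ifs <;> simp_all
  exact congrArg (fun X => N X p.2 q.2) hblock

theorem choi_sub (N M : Matrix c c ℂ →ₗ[ℂ] Matrix d d ℂ) : choi (N - M) = choi N - choi M := by
  ext
  simp [choi_apply]

theorem apply_eq_sum_choi [Fintype c] (N : Matrix c c ℂ →ₗ[ℂ] Matrix d d ℂ) (X : Matrix c c ℂ)
    (p q : d) : N X p q = ∑ i, ∑ j, X i j * choi N (i, p) (j, q) := by
  have hsingle (i j : c) : single i j (X i j) = X i j • single i j (1 : ℂ) := by
    rw [smul_single, smul_eq_mul, mul_one]
  conv_lhs => rw [matrix_eq_sum_single X]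
  simp only [hsingle, map_sum, map_smul, Matrix.sum_apply, Matrix.smul_apply, smul_eq_mul,
    choi_apply]

/-- The Choi isomorphism between linear maps of matrices and matrices on the tensor product. -/
def choiEquiv (c d : Type*) [DecidableEq c] [Fintype c] :
    (Matrix c c ℂ →ₗ[ℂ] Matrix d d ℂ) ≃ₗ[ℂ] Matrix (c × d) (c × d) ℂ where
  toFun := choi
  map_add' N M := by ext; simp [choi_apply]
  map_smul' z N := by ext; simp [choi_apply]
  invFun Z :=
    { toFun X := of fun p q => ∑ i, ∑ j, X i j * Z (i, p) (j, q)
      map_add' _ _ := by ext; simp [add_mul, Finset.sum_add_distrib]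
      map_smul' _ _ := by ext; simp [Finset.mul_sum, mul_assoc] }
  left_inv N := LinearMap.ext fun X => by ext p q; simp [apply_eq_sum_choi N]
  right_inv Z := by ext; simp [choi_apply, single_apply, ite_and]

theorem choi_choiEquiv_symm [Fintype c] (Z : Matrix (c × d) (c × d) ℂ) :
    choi ((choiEquiv c d).symm Z) = Z :=
  (choiEquiv c d).apply_symm_apply Z

theorem map_conjTranspose_iff_isHermitian_choi [Finite c] (N : Matrix c c ℂ →ₗ[ℂ] Matrix d d ℂ) :
    (∀ X, N Xᴴ = (N X)ᴴ) ↔ (choi N).IsHermitian := by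
  have := Fintype.ofFinite c
  refine ⟨fun h => ?_, fun h X => ?_⟩
  · ext p q
    rw [conjTranspose_apply, choi_apply, choi_apply, ← conjTranspose_apply, ← h,
      conjTranspose_single, star_one]
  · ext p q
    simp only [conjTranspose_apply, apply_eq_sum_choi N, star_sum, star_mul', h.apply]
    exact Finset.sum_comm

theorem ampl_vecMulVec_star {r : Type*} [Fintype c] [Fintype d] [DecidableEq d]
    (N : Matrix c c ℂ →ₗ[ℂ] Matrix d d ℂ) (v : r × c → ℂ) :
    ampl r N (vecMulVec v (star v))
      = (of v.curry ⊗ₖ (1 : Matrix d d ℂ)) * choi N * (of v.curry ⊗ₖ (1 : Matrix d d ℂ))ᴴ := by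
  ext ⟨k, p⟩ ⟨l, q⟩
  have hamp : ampl r N (vecMulVec v (star v)) (k, p) (l, q)
      = ∑ i, ∑ j, v (k, i) * star (v (l, j)) * choi N (i, p) (j, q) :=
    apply_eq_sum_choi N _ p q
  simp only [hamp, mul_apply, conjTranspose_apply, kroneckerMap_apply, of_apply,
    Function.curry_apply, one_apply, Fintype.sum_prod_type, mul_ite, mul_one, mul_zero,
    ite_mul, zero_mul, apply_ite star, star_zero, Finset.sum_ite_eq, Finset.mem_univ, if_true,
    Finset.sum_mul]
  rw [Finset.sum_comm]
  refine Finset.sum_congr rfl fun j _ => Finset.sum_congr rfl fun i _ => ?_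
  ring

theorem posSemidef_ampl_of_posSemidef_choi {r : Type*} [Finite r] [Finite c] [Finite d]
    {N : Matrix c c ℂ →ₗ[ℂ] Matrix d d ℂ} (hN : (choi N).PosSemidef)
    {X : Matrix (r × c) (r × c) ℂ} (hX : X.PosSemidef) : (ampl r N X).PosSemidef := by
  classical
  have := Fintype.ofFinite r
  have := Fintype.ofFinite c
  have := Fintype.ofFinite d
  obtain ⟨n, v, rfl⟩ := posSemidef_iff_eq_sum_vecMulVec.1 hX
  rw [map_sum]
  refine posSemidef_sum _ fun i _ => ?_
  rw [ampl_vecMulVec_star]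
  exact hN.mul_mul_conjTranspose_same _

theorem isCP_iff_posSemidef_choi [Finite c] [Finite d] (N : Matrix c c ℂ →ₗ[ℂ] Matrix d d ℂ) :
    IsCP N ↔ (choi N).PosSemidef := by
  refine ⟨fun hN => ?_, fun hN n X hX => posSemidef_ampl_of_posSemidef_choi hN hX⟩
  have := Fintype.ofFinite c
  let e := Fintype.equivFin c
  have hΓ := (posSemidef_vecMulVec_self_star (gammaVec c)).submatrix (Prod.map e.symm id)
  convert (hN _ _ hΓ).submatrix (Prod.map e id) using 1
  ext p q
  simp [choi, ampl]

variable [Fintype c] [Fintype d]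

theorem trace_apply_eq_trace_mul (N : Matrix c c ℂ →ₗ[ℂ] Matrix d d ℂ) (X : Matrix c c ℂ) :
    (N X).trace = (X * (traceRight c d (choi N))ᵀ).trace := by
  simp only [trace, diag_apply, mul_apply, transpose_apply, traceRight_apply,
    apply_eq_sum_choi N X, Finset.mul_sum]
  rw [Finset.sum_comm]
  exact Finset.sum_congr rfl fun _ _ => Finset.sum_comm

theorem trace_map_iff_traceRight_choi (N : Matrix c c ℂ →ₗ[ℂ] Matrix d d ℂ) :
    (∀ X, (N X).trace = X.trace) ↔ traceRight c d (choi N) = 1 := by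
  rw [← transpose_inj, transpose_one, ext_iff_trace_mul_left]
  simp only [trace_apply_eq_trace_mul N, mul_one]

theorem isChannel_iff_choi (N : Matrix c c ℂ →ₗ[ℂ] Matrix d d ℂ) :
    IsChannel N ↔ (choi N).PosSemidef ∧ traceRight c d (choi N) = 1 := by
  rw [IsChannel, isCP_iff_posSemidef_choi, trace_map_iff_traceRight_choi]

end Choi

section DiamondDistance

theorem exists_mem_psdMajorants_conj_eq_posPart {c r : Type*} [Fintype c] [Fintype r]
    [DecidableEq c] [DecidableEq r] {S : Matrix r c ℂ} {T : Matrix c r ℂ} (hTS : T * S = 1)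
    (hST : S * T = 1) {J : Matrix c c ℂ} (hJ : J.IsHermitian) :
    ∃ Z ∈ psdMajorants J, S * Z * Sᴴ = (S * J * Sᴴ)⁺ := by
  have hTS' : Sᴴ * Tᴴ = 1 := by rw [← conjTranspose_mul, hTS, conjTranspose_one]
  have hST' : Tᴴ * Sᴴ = 1 := by rw [← conjTranspose_mul, hST, conjTranspose_one]
  refine ⟨T * (S * J * Sᴴ)⁺ * Tᴴ, ?_, ?_⟩
  · have hJ_conj : T * (S * J * Sᴴ) * Tᴴ = J := by
      rw [Matrix.mul_assoc S, ← Matrix.mul_assoc T, hTS, Matrix.one_mul, Matrix.mul_assoc, hTS',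
        Matrix.mul_one]
    have hmem := conj_mem_psdMajorants
      (posPart_mem_psdMajorants (isHermitian_mul_mul_conjTranspose S hJ)) T
    rwa [hJ_conj] at hmem
  · rw [Matrix.mul_assoc T, ← Matrix.mul_assoc S, hST, Matrix.one_mul, Matrix.mul_assoc, hST',
      Matrix.mul_one]

theorem exists_conjTranspose_mul_self_of_posDef {c r : Type*} [Fintype c] [Fintype r]
    [DecidableEq c] [DecidableEq r] (e : c ≃ r) {σ : Matrix c c ℂ} (hσ : σ.PosDef) :
    ∃ (S : Matrix r c ℂ) (T : Matrix c r ℂ), T * S = 1 ∧ S * T = 1 ∧ Sᴴ * S = σ := by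
  obtain ⟨S, hS, rfl⟩ := CStarAlgebra.isStrictlyPositive_iff_eq_star_mul_self.1
    hσ.isStrictlyPositive
  have hdet := (isUnit_iff_isUnit_det S).1 hS
  refine ⟨S.submatrix e.symm id, S⁻¹.submatrix id e.symm, ?_, ?_, ?_⟩
  · rw [submatrix_mul_equiv, nonsing_inv_mul _ hdet, submatrix_id_id]
  · rw [← submatrix_mul _ _ _ _ _ Function.bijective_id, mul_nonsing_inv _ hdet,
      submatrix_one_equiv]
  · rw [conjTranspose_submatrix, submatrix_mul_equiv, submatrix_id_id, star_eq_conjTranspose]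

theorem trace_ampl_sub_eq_zero {r c d : Type*} [Fintype r] [Fintype d]
    {N M : Matrix c c ℂ →ₗ[ℂ] Matrix d d ℂ} (htr : ∀ X, (N X).trace = (M X).trace)
    (X : Matrix (r × c) (r × c) ℂ) : (ampl r N X - ampl r M X).trace = 0 := by
  simp only [trace_sub, trace_ampl, htr, sub_self]

theorem ampl_mem_psdMajorants {r c d : Type*} [Finite r] [Finite c] [Finite d]
    [DecidableEq c] {N M : Matrix c c ℂ →ₗ[ℂ] Matrix d d ℂ}
    (hM : choi M ∈ psdMajorants (choi N)) {X : Matrix (r × c) (r × c) ℂ} (hX : X.PosSemidef) :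
    ampl r M X ∈ psdMajorants (ampl r N X) := by
  have hMN : (choi (M - N)).PosSemidef := choi_sub M N ▸ hM.2
  exact ⟨posSemidef_ampl_of_posSemidef_choi hM.1 hX, posSemidef_ampl_of_posSemidef_choi hMN hX⟩

variable {c d : Type*} [Fintype c] [Fintype d]

theorem diamondDist_nonneg [DecidableEq d] (N M : Matrix c c ℂ →ₗ[ℂ] Matrix d d ℂ) :
    0 ≤ diamondDist N M := by
  refine Real.sSup_nonneg ?_
  rintro x ⟨n, ω, -, rfl⟩
  exact traceNorm_nonneg _

variable [DecidableEq c]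

theorem re_trace_ampl_le {r : Type*} [Fintype r] {N : Matrix c c ℂ →ₗ[ℂ] Matrix d d ℂ} {μ : ℝ}
    (hμ : ((μ : ℂ) • (1 : Matrix c c ℂ) - traceRight c d (choi N)).PosSemidef)
    {X : Matrix (r × c) (r × c) ℂ} (hX : X.PosSemidef) :
    (ampl r N X).trace.re ≤ μ * X.trace.re := by
  have hblock (k : r) : 0 ≤ μ * (X.submatrix (Prod.mk k) (Prod.mk k)).trace
      - (N (X.submatrix (Prod.mk k) (Prod.mk k))).trace := by
    have hnonneg := trace_mul_nonneg (hX.submatrix (Prod.mk k)) hμ.transpose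
    rwa [transpose_sub, transpose_smul, transpose_one, mul_sub, mul_smul_comm, mul_one, trace_sub,
      trace_smul, smul_eq_mul, ← trace_apply_eq_trace_mul] at hnonneg
  have hX_trace : X.trace = ∑ k, (X.submatrix (Prod.mk k) (Prod.mk k)).trace :=
    Fintype.sum_prod_type _
  have hsum : 0 ≤ μ * X.trace - (ampl r N X).trace := by
    rw [hX_trace, trace_ampl, Finset.mul_sum, ← Finset.sum_sub_distrib]
    exact Finset.sum_nonneg fun k _ => hblock k
  simpa using (Complex.le_def.1 hsum).1

theorem exists_isState_ampl_eq_conj {r : Type*} [Fintype r] {S : Matrix r c ℂ}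
    (hS : (Sᴴ * S).trace = 1) (d : Type*) [Fintype d] [DecidableEq d] :
    ∃ ω : Matrix (r × c) (r × c) ℂ, IsState ω ∧ ∀ N : Matrix c c ℂ →ₗ[ℂ] Matrix d d ℂ,
      ampl r N ω = (S ⊗ₖ (1 : Matrix d d ℂ)) * choi N * (S ⊗ₖ (1 : Matrix d d ℂ))ᴴ := by
  let v : r × c → ℂ := Function.uncurry S
  refine ⟨vecMulVec v (star v), ⟨posSemidef_vecMulVec_self_star v, ?_⟩,
    fun N => ampl_vecMulVec_star N v⟩
  rw [← hS, trace_vecMulVec, dotProduct, Fintype.sum_prod_type_right]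
  simp [v, Function.uncurry, trace, mul_apply, mul_comm]

variable [DecidableEq d] {N M : Matrix c c ℂ →ₗ[ℂ] Matrix d d ℂ}

theorem traceNorm_ampl_sub_le {r : Type*} [Fintype r] [DecidableEq r]
    (htr : ∀ X, (N X).trace = (M X).trace) {Z : Matrix (c × d) (c × d) ℂ}
    (hZ : Z ∈ psdMajorants (choi N - choi M)) {μ : ℝ}
    (hμ : ((μ : ℂ) • (1 : Matrix c c ℂ) - traceRight c d Z).PosSemidef)
    {ω : Matrix (r × c) (r × c) ℂ} (hω : IsState ω) :
    traceNorm (ampl r N ω - ampl r M ω) ≤ 2 * μ := by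
  rw [← choi_choiEquiv_symm Z] at hZ hμ
  rw [← choi_sub] at hZ
  have hbound := re_trace_ampl_le hμ hω.1
  rw [hω.2, Complex.one_re, mul_one] at hbound
  exact (traceNorm_le_two_mul_trace (trace_ampl_sub_eq_zero htr ω)
    (ampl_mem_psdMajorants hZ hω.1)).trans (mul_le_mul_of_nonneg_left hbound zero_le_two)

theorem diamondDist_le (htr : ∀ X, (N X).trace = (M X).trace) {μ : ℝ} (hμ₀ : 0 ≤ μ)
    {Z : Matrix (c × d) (c × d) ℂ} (hZ : Z ∈ psdMajorants (choi N - choi M))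
    (hμ : ((μ : ℂ) • (1 : Matrix c c ℂ) - traceRight c d Z).PosSemidef) :
    diamondDist N M ≤ 2 * μ := by
  refine Real.sSup_le ?_ (mul_nonneg zero_le_two hμ₀)
  rintro x ⟨n, ω, hω, rfl⟩
  exact traceNorm_ampl_sub_le htr hZ hμ hω

theorem traceNorm_le_diamondDist (htr : ∀ X, (N X).trace = (M X).trace)
    (hJ : (choi N - choi M).IsHermitian) {n : ℕ} {ω : Matrix (Fin n × c) (Fin n × c) ℂ}
    (hω : IsState ω) :
    traceNorm (ampl (Fin n) N ω - ampl (Fin n) M ω) ≤ diamondDist N M := by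
  have hpos := posPart_mem_psdMajorants hJ
  have hμ := posSemidef_trace_smul_one_sub (posSemidef_traceRight hpos.1)
  rw [trace_traceRight, Complex.eq_re_of_ofReal_le hpos.1.trace_nonneg] at hμ
  refine le_csSup ⟨2 * ((choi N - choi M)⁺).trace.re, ?_⟩ ⟨n, ω, hω, rfl⟩
  rintro x ⟨m, τ, hτ, rfl⟩
  exact traceNorm_ampl_sub_le htr hpos hμ hτ

theorem exists_majorant_of_posDef (htr : ∀ X, (N X).trace = (M X).trace)
    (hJ : (choi N - choi M).IsHermitian) {σ : Matrix c c ℂ} (hσ : σ.PosDef) (hσ₁ : σ.trace = 1) :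
    ∃ Z ∈ psdMajorants (choi N - choi M),
      2 * (σ * traceRight c d Z).trace.re ≤ diamondDist N M := by
  obtain ⟨S, T, hTS, hST, rfl⟩ :=
    exists_conjTranspose_mul_self_of_posDef (Fintype.equivFin c) hσ
  have hST₁ : (S ⊗ₖ (1 : Matrix d d ℂ)) * (T ⊗ₖ (1 : Matrix d d ℂ)) = 1 := by
    rw [← mul_kronecker_mul, hST, Matrix.one_mul, one_kronecker_one]
  have hTS₁ : (T ⊗ₖ (1 : Matrix d d ℂ)) * (S ⊗ₖ (1 : Matrix d d ℂ)) = 1 := by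
    rw [← mul_kronecker_mul, hTS, Matrix.one_mul, one_kronecker_one]
  obtain ⟨Z, hZ, hZ_conj⟩ := exists_mem_psdMajorants_conj_eq_posPart hTS₁ hST₁ hJ
  refine ⟨Z, hZ, ?_⟩
  obtain ⟨ω, hω, hampl⟩ := exists_isState_ampl_eq_conj hσ₁ d
  have hJ_conj : ampl _ N ω - ampl _ M ω
      = (S ⊗ₖ (1 : Matrix d d ℂ)) * (choi N - choi M) * (S ⊗ₖ (1 : Matrix d d ℂ))ᴴ := by
    rw [Matrix.mul_sub, Matrix.sub_mul, hampl, hampl]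
  have hherm : (ampl _ N ω - ampl _ M ω).IsHermitian :=
    hJ_conj ▸ isHermitian_mul_mul_conjTranspose _ hJ
  calc 2 * (Sᴴ * S * traceRight c d Z).trace.re
      = traceNorm (ampl _ N ω - ampl _ M ω) := by
        rw [traceNorm_eq_two_mul_trace_posPart hherm (trace_ampl_sub_eq_zero htr _), hJ_conj,
          ← trace_conj_kronecker_one, hZ_conj]
    _ ≤ diamondDist N M := traceNorm_le_diamondDist htr hJ hω

/-- Mixing a state with a positive definite one reduces to the positive definite case. -/
theorem exists_majorant_of_isState (htr : ∀ X, (N X).trace = (M X).trace)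
    (hJ : (choi N - choi M).IsHermitian) {μ : ℝ} (hμ : diamondDist N M < 2 * μ)
    {σ : Matrix c c ℂ} (hσ : IsState σ) :
    ∃ Z ∈ psdMajorants (choi N - choi M), (σ * traceRight c d Z).trace.re < μ := by
  have := hσ.nonempty
  obtain ⟨τ, hτ_pos, hτ⟩ := exists_posDef_isState (c := c)
  have hμ₀ : 0 < 2 * μ := (diamondDist_nonneg N M).trans_lt hμ
  obtain ⟨t, ht, ht₁⟩ := exists_between ((div_lt_one hμ₀).2 hμ)
  rw [div_lt_iff₀ hμ₀] at ht
  have ht₀ : 0 ≤ t := by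
    by_contra! hneg
    nlinarith [diamondDist_nonneg N M]
  have hmix := convex_isState hσ hτ ht₀ (sub_nonneg.2 ht₁.le) (by ring)
  obtain ⟨Z, hZ, hle⟩ := exists_majorant_of_posDef htr hJ
    ((hτ_pos.smul (sub_pos.2 ht₁)).posSemidef_add (hσ.1.smul ht₀)) hmix.2
  refine ⟨Z, hZ, ?_⟩
  have hτZ : 0 ≤ (τ * traceRight c d Z).trace.re :=
    (Complex.le_def.1 (trace_mul_nonneg hτ.1 (posSemidef_traceRight hZ.1))).1
  rw [add_mul, trace_add, Complex.add_re, smul_mul_assoc, smul_mul_assoc, trace_smul, trace_smul,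
    Complex.smul_re, Complex.smul_re, smul_eq_mul, smul_eq_mul] at hle
  have hτZ_weighted := mul_nonneg (sub_nonneg.2 ht₁.le) hτZ
  by_contra! hcon
  nlinarith [mul_le_mul_of_nonneg_left hcon ht₀]

theorem exists_majorant_posSemidef_smul_one_sub (htr : ∀ X, (N X).trace = (M X).trace)
    (hJ : (choi N - choi M).IsHermitian) {μ : ℝ} (hμ : diamondDist N M < 2 * μ) :
    ∃ Z ∈ psdMajorants (choi N - choi M),
      ((μ : ℂ) • (1 : Matrix c c ℂ) - traceRight c d Z).PosSemidef := by
  have hconv : Convex ℝ (traceRight c d '' psdMajorants (choi N - choi M)) :=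
    (convex_psdMajorants _).is_linear_image ((traceRight c d).restrictScalars ℝ).isLinear
  obtain ⟨_, ⟨Z, hZ, rfl⟩, hle⟩ := exists_mem_posSemidef_smul_one_sub (μ := μ)
    (Set.Nonempty.image _ ⟨_, posPart_mem_psdMajorants hJ⟩) hconv
    (by rintro _ ⟨Z, hZ, rfl⟩; exact isHermitian_traceRight hZ.1.1) fun σ hσ => by
      obtain ⟨Z, hZ, hlt⟩ := exists_majorant_of_isState htr hJ hμ hσ
      exact ⟨_, ⟨Z, hZ, rfl⟩, hlt⟩
  exact ⟨Z, hZ, hle⟩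

/-- The objective values of the semidefinite program for half the diamond distance of `N` and `M`,
whose constraints are `Z ≥ 0`, `Z ≥ Γ^N - Γ^M` and `μ I ≥ Tr_D Z`. -/
def diamondValues (N M : Matrix c c ℂ →ₗ[ℂ] Matrix d d ℂ) : Set ℝ :=
  {μ | 0 ≤ μ ∧ ∃ Z ∈ psdMajorants (choi N - choi M),
    ((μ : ℂ) • (1 : Matrix c c ℂ) - traceRight c d Z).PosSemidef}

theorem isGLB_diamondValues (htr : ∀ X, (N X).trace = (M X).trace)
    (hJ : (choi N - choi M).IsHermitian) : IsGLB (diamondValues N M) (1 / 2 * diamondDist N M) := by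
  refine ⟨?_, fun l hl => le_of_forall_gt_imp_ge_of_dense fun μ hμ => hl ⟨?_, ?_⟩⟩
  · rintro μ ⟨hμ₀, Z, hZ, hμ⟩
    linarith [diamondDist_le htr hμ₀ hZ hμ]
  · linarith [diamondDist_nonneg N M]
  · exact exists_majorant_posSemidef_smul_one_sub htr hJ (by linarith)

end DiamondDistance

section Simulation

variable {a b ah bh a' b' : Type*}

/-- Hermiticity-preserving, trace-preserving maps: the properties of a channel which the
semidefinite program for the diamond distance uses. -/
structure IsHPTP {c d : Type*} [Fintype c] [Fintype d] (N : Matrix c c ℂ →ₗ[ℂ] Matrix d d ℂ) :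
    Prop where
  map_conjTranspose : ∀ X, N Xᴴ = (N X)ᴴ
  trace_map : ∀ X, (N X).trace = X.trace

section Attach

variable {ρ : Matrix (ah × bh) (ah × bh) ℂ}

theorem attach_conjTranspose (hρ : ρ.IsHermitian) (X : Matrix (a × b) (a × b) ℂ) :
    attach ρ Xᴴ = (attach ρ X)ᴴ := by
  ext p q
  simp [attach, hρ.apply]

theorem attach_eq_submatrix (X : Matrix (a × b) (a × b) ℂ) :
    attach ρ X = (X ⊗ₖ ρ).submatrix (Equiv.prodProdProdComm a b ah bh).symm
      (Equiv.prodProdProdComm a b ah bh).symm := rfl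

variable [Fintype ah] [Fintype bh]

theorem trace_attach [Fintype a] [Fintype b] (X : Matrix (a × b) (a × b) ℂ) :
    (attach ρ X).trace = X.trace * ρ.trace := by
  rw [← trace_kronecker, attach_eq_submatrix]
  exact Equiv.sum_comp (Equiv.prodProdProdComm a b ah bh).symm fun p => (X ⊗ₖ ρ) p p

theorem attach_single [DecidableEq a] [DecidableEq b] [DecidableEq ah] [DecidableEq bh]
    (i j : a × b) :
    attach ρ (single i j 1) = ∑ k, ∑ l, ρ k l • single (Equiv.prodProdProdComm a b ah bh (i, k))
      (Equiv.prodProdProdComm a b ah bh (j, l)) 1 := by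
  have hsingle (k l : ah × bh) : attach (single k l (ρ k l)) (single i j 1)
      = ρ k l • single (Equiv.prodProdProdComm a b ah bh (i, k))
        (Equiv.prodProdProdComm a b ah bh (j, l)) 1 := by
    rw [attach_eq_submatrix, single_kronecker_single, submatrix_single_equiv, Equiv.symm_symm,
      one_mul, smul_single, smul_eq_mul, mul_one]
  simp only [← hsingle]
  conv_lhs => rw [matrix_eq_sum_single ρ]
  ext p q
  simp only [attach, LinearMap.coe_mk, AddHom.coe_mk, submatrix_apply, kroneckerMap_apply,
    Matrix.sum_apply, Finset.mul_sum]

end Attach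

theorem contract_apply {k m n : Type*} [Fintype k] [Fintype m] [Fintype n] [DecidableEq m]
    [DecidableEq n] (ρ : Matrix k k ℂ) (P : Matrix ((m × k) × n) ((m × k) × n) ℂ) (p q : m × n) :
    contract m n ρ P p q = ∑ x, ∑ y, ρ x y * P ((p.1, x), p.2) ((q.1, y), q.2) := by
  simp only [contract, traceMid, LinearMap.comp_apply, LinearMap.coe_mk, AddHom.coe_mk, of_apply,
    LinearMap.mulLeft_apply, mul_apply, kroneckerMap_apply, transpose_apply]
  refine .trans (Finset.sum_congr rfl fun y _ => ?_) Finset.sum_comm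
  simp [Fintype.sum_prod_type (α₁ := m × k), Fintype.sum_prod_type (α₁ := m), one_apply]

section HPTP

variable {c d : Type*} [Fintype c] [Fintype d] {N M : Matrix c c ℂ →ₗ[ℂ] Matrix d d ℂ}

theorem IsChannel.isHPTP (hN : IsChannel N) : IsHPTP N where
  map_conjTranspose := by
    classical
    exact (map_conjTranspose_iff_isHermitian_choi N).2 ((isCP_iff_posSemidef_choi N).1 hN.1).1
  trace_map := hN.2

theorem IsHPTP.nonempty [Nonempty c] (hN : IsHPTP N) : Nonempty d := by
  classical
  by_contra hd
  rw [not_nonempty_iff] at hd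
  have htr := hN.trace_map (single (Classical.arbitrary c) (Classical.arbitrary c) 1)
  rw [trace_single_eq_same, trace_eq_zero_of_isEmpty] at htr
  exact zero_ne_one htr

theorem IsHPTP.isHermitian_choi [DecidableEq c] (hN : IsHPTP N) : (choi N).IsHermitian :=
  (map_conjTranspose_iff_isHermitian_choi N).1 hN.map_conjTranspose

theorem IsHPTP.isGLB_diamondValues [DecidableEq c] [DecidableEq d] (hN : IsHPTP N)
    (hM : IsHPTP M) : IsGLB (diamondValues N M) (1 / 2 * diamondDist N M) :=
  QSim.isGLB_diamondValues (fun X => (hN.trace_map X).trans (hM.trace_map X).symm)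
    (hN.isHermitian_choi.sub hM.isHermitian_choi)

end HPTP

theorem IsHPTP.simulation [Fintype a] [Fintype b] [Fintype ah] [Fintype bh] [Fintype a']
    [Fintype b'] {ρ : Matrix (ah × bh) (ah × bh) ℂ}
    {P : Matrix ((a × ah) × (b × bh)) ((a × ah) × (b × bh)) ℂ →ₗ[ℂ] Matrix (a' × b') (a' × b') ℂ}
    (hP : IsHPTP P) (hρ : ρ.IsHermitian) (hρ₁ : ρ.trace = 1) : IsHPTP (simulation ρ P) where
  map_conjTranspose X := by
    simp only [QSim.simulation, LinearMap.comp_apply, attach_conjTranspose hρ,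
      hP.map_conjTranspose]
  trace_map X := by
    rw [QSim.simulation, LinearMap.comp_apply, hP.trace_map, trace_attach, hρ₁, mul_one]

/-- The completely depolarizing channel is C-PPT-P. -/
theorem exists_isCPPTP [Fintype a] [Fintype b] [Fintype a'] [Fintype b']
    (h : Nonempty (a × b) → Nonempty (a' × b')) :
    ∃ P : Matrix (a × b) (a × b) ℂ →ₗ[ℂ] Matrix (a' × b') (a' × b') ℂ, IsCPPTP P := by
  classical
  let τ : Matrix (a' × b') (a' × b') ℂ := (Fintype.card (a' × b') : ℝ)⁻¹ • 1
  let P : Matrix (a × b) (a × b) ℂ →ₗ[ℂ] Matrix (a' × b') (a' × b') ℂ :=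
    (traceLinearMap (a × b) ℂ ℂ).smulRight τ
  have hcp : IsCP P := by
    have hchoi : choi P = (1 : Matrix (a × b) (a × b) ℂ) ⊗ₖ τ := by
      ext p q
      rcases eq_or_ne p.1 q.1 with hpq | hpq <;> simp [choi_apply, P, one_apply, hpq]
    rw [isCP_iff_posSemidef_choi, hchoi]
    exact PosSemidef.one.kronecker (PosSemidef.one.smul (by positivity))
  have htrace (X : Matrix (a × b) (a × b) ℂ) : (P X).trace = X.trace := by
    rcases isEmpty_or_nonempty (a × b) with hab | hab
    · rw [Subsingleton.elim X 0, map_zero, trace_zero, trace_zero]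
    · have := h hab
      change (X.trace • τ).trace = X.trace
      rw [trace_smul, (isState_inv_card_smul_one (a' × b')).2, smul_eq_mul, mul_one]
  have htranspose : transposeRight a' b' ∘ₗ P ∘ₗ transposeRight a b = P := by
    have hτ : transposeRight a' b' τ = τ := by
      rw [LinearMap.map_smul_of_tower]
      congr 1
      ext p q
      exact if_congr (by grind) rfl rfl
    refine LinearMap.ext fun X => ?_
    change transposeRight a' b' (X.trace • τ) = X.trace • τ
    rw [map_smul, hτ]
  exact ⟨P, ⟨hcp, htrace⟩, htranspose.symm ▸ hcp⟩

variable [Fintype a] [Fintype b] [Fintype ah] [Fintype bh]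
  [DecidableEq a] [DecidableEq b] [DecidableEq ah] [DecidableEq bh]

/-- The Choi operator of a map `P : (AÂ)(BB̂) → A'B'`, with its systems in the order
`(AB)(ÂB̂)(A'B')` of the semidefinite program. -/
def orderedChoi (a b ah bh a' b' : Type*) [Fintype a] [Fintype b] [Fintype ah] [Fintype bh]
    [DecidableEq a] [DecidableEq b] [DecidableEq ah] [DecidableEq bh] :
    (Matrix ((a × ah) × (b × bh)) ((a × ah) × (b × bh)) ℂ →ₗ[ℂ] Matrix (a' × b') (a' × b') ℂ) ≃
      Matrix (((a × b) × (ah × bh)) × (a' × b')) (((a × b) × (ah × bh)) × (a' × b')) ℂ :=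
  (choiEquiv _ _).toEquiv.trans <|
    let e := (Equiv.prodProdProdComm a ah b bh).prodCongr (Equiv.refl (a' × b'))
    reindex e e

theorem orderedChoi_apply
    (P : Matrix ((a × ah) × (b × bh)) ((a × ah) × (b × bh)) ℂ →ₗ[ℂ] Matrix (a' × b') (a' × b') ℂ)
    (p q : ((a × b) × (ah × bh)) × (a' × b')) :
    orderedChoi a b ah bh a' b' P p q = P (single (Equiv.prodProdProdComm a b ah bh p.1)
      (Equiv.prodProdProdComm a b ah bh q.1) 1) p.2 q.2 :=
  choi_apply P _ _

variable
    (P : Matrix ((a × ah) × (b × bh)) ((a × ah) × (b × bh)) ℂ →ₗ[ℂ] Matrix (a' × b') (a' × b') ℂ)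

theorem posSemidef_orderedChoi_iff :
    (orderedChoi a b ah bh a' b' P).PosSemidef ↔ (choi P).PosSemidef :=
  posSemidef_submatrix_equiv
    ((Equiv.prodProdProdComm a b ah bh).prodCongr (Equiv.refl (a' × b'))) (M := choi P)

theorem transposeBob_orderedChoi :
    transposeBob a b ah bh a' b' (orderedChoi a b ah bh a' b' P) = orderedChoi a b ah bh a' b'
      (transposeRight a' b' ∘ₗ P ∘ₗ transposeRight (a × ah) (b × bh)) := by
  have hsingle (i j : (a × ah) × (b × bh)) : transposeRight (a × ah) (b × bh) (single i j 1)
      = single (i.1, j.2) (j.1, i.2) 1 := by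
    ext p q
    simp only [transposeRight, LinearMap.coe_mk, AddHom.coe_mk, of_apply, single_apply,
      Prod.ext_iff]
    exact if_congr (by tauto) rfl rfl
  ext p q
  simp only [transposeBob, LinearMap.coe_mk, AddHom.coe_mk, of_apply, orderedChoi_apply,
    LinearMap.comp_apply, hsingle]
  rfl

variable [Fintype a'] [Fintype b']

theorem traceRight_orderedChoi_eq_one_iff :
    traceRight ((a × b) × (ah × bh)) (a' × b') (orderedChoi a b ah bh a' b' P) = 1 ↔
      traceRight ((a × ah) × (b × bh)) (a' × b') (choi P) = 1 := by
  let e := Equiv.prodProdProdComm a b ah bh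
  have hreindex : traceRight ((a × b) × (ah × bh)) (a' × b') (orderedChoi a b ah bh a' b' P)
      = reindex e.symm e.symm (traceRight ((a × ah) × (b × bh)) (a' × b') (choi P)) := rfl
  rw [hreindex, ← (reindex e.symm e.symm).injective.eq_iff (b := 1)]
  simp

theorem isCPPTP_iff_orderedChoi :
    IsCPPTP P ↔ (orderedChoi a b ah bh a' b' P).PosSemidef ∧
      (transposeBob a b ah bh a' b' (orderedChoi a b ah bh a' b' P)).PosSemidef ∧
      traceRight ((a × b) × (ah × bh)) (a' × b') (orderedChoi a b ah bh a' b' P) = 1 := by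
  rw [IsCPPTP, isChannel_iff_choi, isCP_iff_posSemidef_choi, transposeBob_orderedChoi,
    traceRight_orderedChoi_eq_one_iff, posSemidef_orderedChoi_iff, posSemidef_orderedChoi_iff,
    and_assoc, and_comm (a := _ = _)]

variable [DecidableEq a'] [DecidableEq b']

theorem choi_simulation (ρ : Matrix (ah × bh) (ah × bh) ℂ) :
    choi (simulation ρ P)
      = contract (a × b) (a' × b') ρ (orderedChoi a b ah bh a' b' P) := by
  ext p q
  simp only [choi_apply, simulation, LinearMap.comp_apply, attach_single, map_sum, map_smul,
    Matrix.sum_apply, Matrix.smul_apply, smul_eq_mul, contract_apply, orderedChoi_apply]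

theorem mem_simPrimalValues_iff
    (N : Matrix (a × b) (a × b) ℂ →ₗ[ℂ] Matrix (a' × b') (a' × b') ℂ)
    (ρ : Matrix (ah × bh) (ah × bh) ℂ) (μ : ℝ) :
    μ ∈ simPrimalValues N ρ ↔
      ∃ P : Matrix ((a × ah) × (b × bh)) ((a × ah) × (b × bh)) ℂ →ₗ[ℂ]
        Matrix (a' × b') (a' × b') ℂ, IsCPPTP P ∧ μ ∈ diamondValues N (simulation ρ P) := by
  constructor
  · rintro ⟨Z, Q, hμ₀, hZ, hQ, hμ, hT, htr, hZJ⟩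
    obtain ⟨P, rfl⟩ := (orderedChoi a b ah bh a' b').surjective Q
    rw [← choi_simulation] at hZJ
    exact ⟨P, (isCPPTP_iff_orderedChoi P).2 ⟨hQ, hT, htr⟩, hμ₀, Z, ⟨hZ, hZJ⟩, hμ⟩
  · rintro ⟨P, hP, hμ₀, Z, ⟨hZ, hZJ⟩, hμ⟩
    obtain ⟨hQ, hT, htr⟩ := (isCPPTP_iff_orderedChoi P).1 hP
    rw [choi_simulation] at hZJ
    exact ⟨Z, _, hμ₀, hZ, hQ, hμ, hT, htr, hZJ⟩

theorem isGLB_simPrimalValues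
    {N : Matrix (a × b) (a × b) ℂ →ₗ[ℂ] Matrix (a' × b') (a' × b') ℂ}
    {ρ : Matrix (ah × bh) (ah × bh) ℂ} (hN : IsHPTP N) (hρ : ρ.IsHermitian) (hρ₁ : ρ.trace = 1) :
    IsGLB (simPrimalValues N ρ) (errPPT N ρ) := by
  have hGLB {P : Matrix ((a × ah) × (b × bh)) ((a × ah) × (b × bh)) ℂ →ₗ[ℂ]
      Matrix (a' × b') (a' × b') ℂ} (hP : IsCPPTP P) :
      IsGLB (diamondValues N (simulation ρ P)) (1 / 2 * diamondDist N (simulation ρ P)) :=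
    hN.isGLB_diamondValues (hP.1.isHPTP.simulation hρ hρ₁)
  refine ⟨fun μ hμ => ?_, fun l hl => ?_⟩
  · obtain ⟨P, hP, hμ⟩ := (mem_simPrimalValues_iff N ρ μ).1 hμ
    refine le_trans (mul_le_mul_of_nonneg_left (csInf_le ⟨0, ?_⟩ ⟨P, hP, rfl⟩) one_half_pos.le)
      ((hGLB hP).1 hμ)
    rintro _ ⟨P', -, rfl⟩
    exact diamondDist_nonneg _ _
  · suffices h : 2 * l ≤ sInf {x : ℝ | ∃ P : Matrix ((a × ah) × (b × bh)) ((a × ah) × (b × bh)) ℂ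
        →ₗ[ℂ] Matrix (a' × b') (a' × b') ℂ, IsCPPTP P ∧ x = diamondDist N (simulation ρ P)} by
      rw [errPPT]
      linarith
    refine le_csInf ?_ ?_
    · obtain ⟨P, hP⟩ := exists_isCPPTP (a := a × ah) (b := b × bh) (a' := a') (b' := b')
        fun ⟨i, j⟩ => have : Nonempty (a × b) := ⟨(i.1, j.1)⟩; hN.nonempty
      exact ⟨_, P, hP, rfl⟩
    · rintro _ ⟨P, hP, rfl⟩
      have hl_le : l ≤ 1 / 2 * diamondDist N (simulation ρ P) :=
        (hGLB hP).2 fun μ hμ => hl ((mem_simPrimalValues_iff N ρ μ).2 ⟨P, hP, hμ⟩)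
      linarith

end Simulation

section BlockDiagonal

variable {p q : Type*}

theorem diag₂_sub_diag₂ (X X' : Matrix p p ℂ) (Y Y' : Matrix q q ℂ) :
    diag₂ X Y - diag₂ X' Y' = diag₂ (X - X') (Y - Y') := by
  simp [diag₂, sub_eq_add_neg, fromBlocks_neg, fromBlocks_add]

theorem diag₂_conjTranspose (X : Matrix p p ℂ) (Y : Matrix q q ℂ) :
    (diag₂ X Y)ᴴ = diag₂ Xᴴ Yᴴ := by
  simp [diag₂, fromBlocks_conjTranspose]

theorem isHermitian_diag₂ {X : Matrix p p ℂ} {Y : Matrix q q ℂ} (hX : X.IsHermitian)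
    (hY : Y.IsHermitian) : (diag₂ X Y).IsHermitian := by
  rw [IsHermitian, diag₂_conjTranspose, hX, hY]

theorem toBlocks₁₁_conjTranspose (M : Matrix (p ⊕ q) (p ⊕ q) ℂ) :
    Mᴴ.toBlocks₁₁ = M.toBlocks₁₁ᴴ := rfl

theorem toBlocks₂₂_conjTranspose (M : Matrix (p ⊕ q) (p ⊕ q) ℂ) :
    Mᴴ.toBlocks₂₂ = M.toBlocks₂₂ᴴ := rfl

theorem toBlocks₁₁_diag₂ (X : Matrix p p ℂ) (Y : Matrix q q ℂ) :
    (diag₂ X Y).toBlocks₁₁ = X := rfl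

theorem toBlocks₂₂_diag₂ (X : Matrix p p ℂ) (Y : Matrix q q ℂ) :
    (diag₂ X Y).toBlocks₂₂ = Y := rfl

theorem diag₂_apply_inl (X : Matrix p p ℂ) (Y : Matrix q q ℂ) (i j : p) :
    diag₂ X Y (Sum.inl i) (Sum.inl j) = X i j := rfl

theorem posSemidef_diag₂ [Finite p] [Finite q] {X : Matrix p p ℂ} {Y : Matrix q q ℂ} :
    (diag₂ X Y).PosSemidef ↔ X.PosSemidef ∧ Y.PosSemidef := by
  refine ⟨fun h => ⟨h.submatrix Sum.inl, h.submatrix Sum.inr⟩, fun ⟨hX, hY⟩ => ?_⟩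
  classical
  have := Fintype.ofFinite p
  have := Fintype.ofFinite q
  obtain ⟨C, rfl⟩ := CStarAlgebra.nonneg_iff_eq_star_mul_self.mp hX.nonneg
  obtain ⟨D, rfl⟩ := CStarAlgebra.nonneg_iff_eq_star_mul_self.mp hY.nonneg
  have hsq : diag₂ (star C * C) (star D * D) = (diag₂ C D)ᴴ * diag₂ C D := by
    simp [diag₂, fromBlocks_conjTranspose, fromBlocks_multiply, star_eq_conjTranspose]
  exact hsq ▸ posSemidef_conjTranspose_mul_self _

variable [Fintype p] [Fintype q]

theorem trace_mul_diag₂ (M : Matrix (p ⊕ q) (p ⊕ q) ℂ) (X : Matrix p p ℂ) (Y : Matrix q q ℂ) :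
    (M * diag₂ X Y).trace = (M.toBlocks₁₁ * X).trace + (M.toBlocks₂₂ * Y).trace := by
  conv_lhs => rw [← fromBlocks_toBlocks M, diag₂, fromBlocks_multiply]
  simp [trace]

theorem trace_diag₂_mul (M : Matrix (p ⊕ q) (p ⊕ q) ℂ) (X : Matrix p p ℂ) (Y : Matrix q q ℂ) :
    (diag₂ X Y * M).trace = (X * M.toBlocks₁₁).trace + (Y * M.toBlocks₂₂).trace := by
  rw [trace_mul_comm, trace_mul_diag₂, trace_mul_comm X, trace_mul_comm Y]

theorem posSemidef_unit_iff {M : Matrix Unit Unit ℂ} : M.PosSemidef ↔ 0 ≤ M () () := by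
  have hM : M = diagonal fun _ => M () () := by ext; simp
  rw [hM, posSemidef_diagonal_iff]
  simp

end BlockDiagonal

section Adjoints

theorem SDP.adjoint_eq_of_trace_mul {m n : Type*} [Fintype m] [Fintype n]
    {Φ : Matrix n n ℂ →ₗ[ℂ] Matrix m m ℂ} (hΦ : ∀ Y, Φ Yᴴ = (Φ Y)ᴴ) {X : Matrix m m ℂ}
    {M : Matrix n n ℂ} (h : ∀ Y, (Y * M).trace = (Φ Y * X).trace) : SDP.adjoint Φ X = M := by
  classical
  ext i j
  rw [SDP.adjoint, of_apply, ← hΦ, ← h, conjTranspose_single, star_one, trace_single_mul, one_smul]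

section Contract

variable {k m n : Type*}

/-- The reordering of tensor factors which turns `X ⊗ₖ σ` into `insertMid X σ`. -/
def midEquiv (m k n : Type*) : (m × k) × n ≃ (m × n) × k where
  toFun p := ((p.1.1, p.2), p.1.2)
  invFun p := ((p.1.1, p.2), p.1.2)

theorem insertMid_eq_submatrix (X : Matrix (m × n) (m × n) ℂ) (σ : Matrix k k ℂ) :
    insertMid X σ = (X ⊗ₖ σ).submatrix (midEquiv m k n) (midEquiv m k n) := rfl

variable [Fintype k] [Fintype m] [Fintype n]

theorem insertMid_mul_insertMid (X Y : Matrix (m × n) (m × n) ℂ) (σ τ : Matrix k k ℂ) :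
    insertMid X σ * insertMid Y τ = insertMid (X * Y) (σ * τ) := by
  simp only [insertMid_eq_submatrix, submatrix_mul_equiv, mul_kronecker_mul]

theorem trace_traceMid_mul [DecidableEq k] (Q : Matrix ((m × k) × n) ((m × k) × n) ℂ)
    (X : Matrix (m × n) (m × n) ℂ) :
    (traceMid m k n Q * X).trace = (Q * insertMid X 1).trace := by
  let e := midEquiv m k n
  have hright : traceMid m k n Q = traceRight (m × n) k (Q.submatrix e.symm e.symm) := rfl
  have hmul : Q * insertMid X 1
      = (Q.submatrix e.symm e.symm * (X ⊗ₖ (1 : Matrix k k ℂ))).submatrix e e := by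
    rw [← submatrix_mul_equiv _ _ e e e, submatrix_submatrix, e.symm_comp_self, submatrix_id_id]
    rfl
  rw [hright, trace_traceRight_mul, hmul]
  exact (e.sum_comp fun p => (Q.submatrix e.symm e.symm * (X ⊗ₖ (1 : Matrix k k ℂ))) p p).symm

variable [DecidableEq m] [DecidableEq n] {ρ : Matrix k k ℂ}

theorem contract_conjTranspose (hρ : ρ.IsHermitian) (P : Matrix ((m × k) × n) ((m × k) × n) ℂ) :
    contract m n ρ Pᴴ = (contract m n ρ P)ᴴ := by
  ext p q
  simp only [conjTranspose_apply, contract_apply, star_sum, star_mul', hρ.apply]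
  exact Finset.sum_comm

theorem trace_contract_mul (P : Matrix ((m × k) × n) ((m × k) × n) ℂ)
    (X : Matrix (m × n) (m × n) ℂ) :
    (contract m n ρ P * X).trace = (P * insertMid X ρᵀ).trace := by
  classical
  have hone : ((1 : Matrix m m ℂ) ⊗ₖ ρᵀ) ⊗ₖ (1 : Matrix n n ℂ) = insertMid 1 ρᵀ := by
    rw [insertMid, ← one_kronecker_one]
    ext p q
    exact mul_right_comm _ _ _
  rw [contract, LinearMap.comp_apply, trace_traceMid_mul, LinearMap.mulLeft_apply,
    trace_mul_cycle, trace_mul_comm, hone, insertMid_mul_insertMid, Matrix.mul_one, Matrix.one_mul]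

end Contract

variable {a b ah bh a' b' : Type*}
  (X : Matrix (((a × b) × (ah × bh)) × (a' × b')) (((a × b) × (ah × bh)) × (a' × b')) ℂ)

theorem transposeBob_conjTranspose :
    transposeBob a b ah bh a' b' Xᴴ = (transposeBob a b ah bh a' b' X)ᴴ := rfl

theorem trace_transposeBob_mul [Fintype a] [Fintype b] [Fintype ah] [Fintype bh] [Fintype a']
    [Fintype b']
    (Y : Matrix (((a × b) × (ah × bh)) × (a' × b')) (((a × b) × (ah × bh)) × (a' × b')) ℂ) :
    (transposeBob a b ah bh a' b' X * Y).trace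
      = (X * transposeBob a b ah bh a' b' Y).trace := by
  let swapBob (p q : ((a × b) × (ah × bh)) × (a' × b')) : ((a × b) × (ah × bh)) × (a' × b') :=
    (((p.1.1.1, q.1.1.2), (p.1.2.1, q.1.2.2)), (p.2.1, q.2.2))
  have hswap : Function.Involutive fun p : (((a × b) × (ah × bh)) × (a' × b')) ×
      (((a × b) × (ah × bh)) × (a' × b')) => (swapBob p.1 p.2, swapBob p.2 p.1) := fun _ => rfl
  simp only [trace, diag_apply, mul_apply, ← Fintype.sum_prod_type']
  exact Equiv.sum_comp hswap.toPerm fun p => X p.1 p.2 * transposeBob a b ah bh a' b' Y p.2 p.1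

end Adjoints

section StandardForm

/-- Index type of the variable `Y = diag(μ, Z, P)` of the standard form. -/
abbrev PrimalIndex (a b ah bh a' b' : Type*) :=
  Unit ⊕ (((a × b) × (a' × b')) ⊕ (((a × b) × (ah × bh)) × (a' × b')))

/-- Index type of the constraints of the standard form, and of the dual variable
`X = diag(X₁, X₂, X₃, W⁻, W⁺)`, in which `W = W⁺ - W⁻`. -/
abbrev DualIndex (a b ah bh a' b' : Type*) :=
  (a × b) ⊕ (((a × b) × (a' × b')) ⊕ ((((a × b) × (ah × bh)) × (a' × b')) ⊕
    (((a × b) × (ah × bh)) ⊕ ((a × b) × (ah × bh)))))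

variable {a b ah bh a' b' : Type*} [Fintype a] [Fintype b] [Fintype ah] [Fintype bh]
  [Fintype a'] [Fintype b'] [DecidableEq a] [DecidableEq b] [DecidableEq ah] [DecidableEq bh]
  [DecidableEq a'] [DecidableEq b']
  {N : Matrix (a × b) (a × b) ℂ →ₗ[ℂ] Matrix (a' × b') (a' × b') ℂ}
  {ρ : Matrix (ah × bh) (ah × bh) ℂ}
  (Y : Matrix (PrimalIndex a b ah bh a' b') (PrimalIndex a b ah bh a' b') ℂ)
  (X : Matrix (DualIndex a b ah bh a' b') (DualIndex a b ah bh a' b') ℂ)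

theorem simSDP_A : (simSDP N ρ).A = diag₂ 0 (diag₂ (choi N) (diag₂ 0 (diag₂ 1 (-1)))) := rfl

theorem simSDP_B : (simSDP N ρ).B = diag₂ 1 (diag₂ 0 0) := rfl

theorem simSDP_Φ_apply : (simSDP N ρ).Φ Y =
    diag₂ (Y (Sum.inl ()) (Sum.inl ()) • 1
        - traceRight (a × b) (a' × b') Y.toBlocks₂₂.toBlocks₁₁)
      (diag₂ (Y.toBlocks₂₂.toBlocks₁₁ + contract (a × b) (a' × b') ρ Y.toBlocks₂₂.toBlocks₂₂)
        (diag₂ (transposeBob a b ah bh a' b' Y.toBlocks₂₂.toBlocks₂₂)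
          (diag₂ (traceRight ((a × b) × (ah × bh)) (a' × b') Y.toBlocks₂₂.toBlocks₂₂)
            (-traceRight ((a × b) × (ah × bh)) (a' × b') Y.toBlocks₂₂.toBlocks₂₂)))) := rfl

theorem simSDP_Φ_conjTranspose (hρ : ρ.IsHermitian) :
    (simSDP N ρ).Φ Yᴴ = ((simSDP N ρ).Φ Y)ᴴ := by
  simp only [simSDP_Φ_apply, diag₂_conjTranspose, toBlocks₁₁_conjTranspose,
    toBlocks₂₂_conjTranspose, conjTranspose_sub, conjTranspose_add, conjTranspose_neg,
    conjTranspose_smul, conjTranspose_one, conjTranspose_apply, traceRight_conjTranspose,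
    contract_conjTranspose hρ, transposeBob_conjTranspose]

theorem simSDP_isHermitian (hN : (choi N).IsHermitian) (hρ : ρ.IsHermitian) :
    (simSDP N ρ).IsHermitian := by
  refine ⟨?_, ?_, fun Y hY => ?_⟩
  · exact isHermitian_diag₂ isHermitian_zero <| isHermitian_diag₂ hN <|
      isHermitian_diag₂ isHermitian_zero <| isHermitian_diag₂ isHermitian_one isHermitian_one.neg
  · exact isHermitian_diag₂ isHermitian_one (isHermitian_diag₂ isHermitian_zero isHermitian_zero)
  · rw [IsHermitian, ← simSDP_Φ_conjTranspose Y hρ, hY]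

theorem posSemidef_simSDP_Φ_sub_A_iff : ((simSDP N ρ).Φ Y - (simSDP N ρ).A).PosSemidef ↔
    (Y (Sum.inl ()) (Sum.inl ()) • 1
      - traceRight (a × b) (a' × b') Y.toBlocks₂₂.toBlocks₁₁).PosSemidef ∧
    (Y.toBlocks₂₂.toBlocks₁₁
      - (choi N - contract (a × b) (a' × b') ρ Y.toBlocks₂₂.toBlocks₂₂)).PosSemidef ∧
    (transposeBob a b ah bh a' b' Y.toBlocks₂₂.toBlocks₂₂).PosSemidef ∧
    traceRight ((a × b) × (ah × bh)) (a' × b') Y.toBlocks₂₂.toBlocks₂₂ = 1 := by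
  have heq {A : Matrix ((a × b) × (ah × bh)) ((a × b) × (ah × bh)) ℂ} :
      (A - 1).PosSemidef ∧ (-A - -1).PosSemidef ↔ A = 1 := by
    refine ⟨fun h => eq_of_posSemidef_sub h.1 h.2, ?_⟩
    rintro rfl
    simp only [sub_self, and_self, PosSemidef.zero]
  simp only [simSDP_Φ_apply, simSDP_A, diag₂_sub_diag₂, posSemidef_diag₂, sub_zero,
    sub_sub_eq_add_sub, heq]

theorem trace_simSDP_B_mul :
    ((simSDP N ρ).B * Y).trace = Y (Sum.inl ()) (Sum.inl ()) := by
  simp only [simSDP_B, trace_diag₂_mul, Matrix.one_mul, Matrix.zero_mul, trace_zero, add_zero]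
  simp [trace, toBlocks₁₁]

theorem simSDP_primalValues : (simSDP N ρ).primalValues = simPrimalValues N ρ := by
  ext v
  constructor
  · rintro ⟨Y, hY, hΦ, rfl⟩
    obtain ⟨hμ, hZJ, hT, htr⟩ := (posSemidef_simSDP_Φ_sub_A_iff Y).1 hΦ
    obtain ⟨μ, hμ₀, hYμ⟩ := RCLike.nonneg_iff_exists_ofReal.1 (hY.diag_nonneg (i := Sum.inl ()))
    rw [trace_simSDP_B_mul]
    rw [← hYμ] at hμ ⊢
    exact ⟨_, _, hμ₀, hY.submatrix (Sum.inr ∘ Sum.inl), hY.submatrix (Sum.inr ∘ Sum.inr), hμ, hT,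
      htr, hZJ⟩
  · rintro ⟨Z, P, hv, hZ, hP, hμ, hT, htr, hZJ⟩
    refine ⟨diag₂ (of fun _ _ => (v : ℂ)) (diag₂ Z P), ?_,
      (posSemidef_simSDP_Φ_sub_A_iff _).2 ⟨hμ, hZJ, hT, htr⟩, ?_⟩
    · rw [posSemidef_diag₂, posSemidef_diag₂, posSemidef_unit_iff]
      exact ⟨Complex.zero_le_real.2 hv, hZ, hP⟩
    · rw [trace_simSDP_B_mul, diag₂_apply_inl, of_apply, Complex.ofReal_re]

theorem simSDP_adjoint (hρ : ρ.IsHermitian) : SDP.adjoint (simSDP N ρ).Φ X =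
    diag₂ (of fun _ _ => X.toBlocks₁₁.trace)
      (diag₂ (X.toBlocks₂₂.toBlocks₁₁ - X.toBlocks₁₁ ⊗ₖ (1 : Matrix (a' × b') (a' × b') ℂ))
        (insertMid X.toBlocks₂₂.toBlocks₁₁ ρᵀ
          + transposeBob a b ah bh a' b' X.toBlocks₂₂.toBlocks₂₂.toBlocks₁₁
          - (X.toBlocks₂₂.toBlocks₂₂.toBlocks₂₂.toBlocks₂₂
            - X.toBlocks₂₂.toBlocks₂₂.toBlocks₂₂.toBlocks₁₁) ⊗ₖ
              (1 : Matrix (a' × b') (a' × b') ℂ))) := by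
  refine SDP.adjoint_eq_of_trace_mul (fun Y => simSDP_Φ_conjTranspose Y hρ) fun Y => ?_
  have hμ (t : ℂ) : (Y.toBlocks₁₁ * of fun _ _ => t).trace
      = Y (Sum.inl ()) (Sum.inl ()) * t := by
    simp [trace, mul_apply, toBlocks₁₁]
  simp only [simSDP_Φ_apply, trace_mul_diag₂, trace_diag₂_mul, hμ, sub_mul, add_mul, neg_mul,
    smul_mul_assoc, one_mul, trace_sub, trace_add, trace_neg, trace_smul, smul_eq_mul, mul_sub,
    mul_add, ← trace_traceRight_mul, trace_contract_mul, trace_transposeBob_mul]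
  ring

theorem posSemidef_simSDP_B_sub_adjoint_iff (hρ : ρ.IsHermitian) :
    ((simSDP N ρ).B - SDP.adjoint (simSDP N ρ).Φ X).PosSemidef ↔
      X.toBlocks₁₁.trace ≤ 1 ∧
      (X.toBlocks₁₁ ⊗ₖ (1 : Matrix (a' × b') (a' × b') ℂ)
        - X.toBlocks₂₂.toBlocks₁₁).PosSemidef ∧
      ((X.toBlocks₂₂.toBlocks₂₂.toBlocks₂₂.toBlocks₂₂
          - X.toBlocks₂₂.toBlocks₂₂.toBlocks₂₂.toBlocks₁₁) ⊗ₖ (1 : Matrix (a' × b') (a' × b') ℂ)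
        - (insertMid X.toBlocks₂₂.toBlocks₁₁ ρᵀ
          + transposeBob a b ah bh a' b' X.toBlocks₂₂.toBlocks₂₂.toBlocks₁₁)).PosSemidef := by
  simp only [simSDP_adjoint X hρ, simSDP_B, diag₂_sub_diag₂, posSemidef_diag₂, zero_sub, neg_sub,
    posSemidef_unit_iff, Matrix.sub_apply, one_apply_eq, of_apply, sub_nonneg]

theorem trace_simSDP_A_mul :
    ((simSDP N ρ).A * X).trace = (choi N * X.toBlocks₂₂.toBlocks₁₁).trace
      - (X.toBlocks₂₂.toBlocks₂₂.toBlocks₂₂.toBlocks₂₂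
        - X.toBlocks₂₂.toBlocks₂₂.toBlocks₂₂.toBlocks₁₁).trace := by
  simp only [simSDP_A, trace_diag₂_mul, zero_mul, trace_zero, one_mul, neg_mul, trace_neg,
    trace_sub]
  ring

theorem simSDP_dualValues (hρ : ρ.IsHermitian) :
    (simSDP N ρ).dualValues = simDualValues N ρ := by
  ext v
  constructor
  · rintro ⟨X, hX, hΦ, rfl⟩
    obtain ⟨htr, hX₂, hW⟩ := (posSemidef_simSDP_B_sub_adjoint_iff X hρ).1 hΦ
    rw [trace_simSDP_A_mul, Complex.sub_re]
    exact ⟨_, _, _, _, hX.submatrix Sum.inl, hX.submatrix (Sum.inr ∘ Sum.inl),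
      hX.submatrix (Sum.inr ∘ Sum.inr ∘ Sum.inl),
      .sub (hX.1.submatrix (Sum.inr ∘ Sum.inr ∘ Sum.inr ∘ Sum.inr))
        (hX.1.submatrix (Sum.inr ∘ Sum.inr ∘ Sum.inr ∘ Sum.inl)),
      (Complex.le_def.1 htr).1, hX₂, hW, rfl⟩
  · rintro ⟨X₁, X₂, X₃, W, hX₁, hX₂, hX₃, hW, htr, hX₁₂, hWX, rfl⟩
    have hWsub : W⁺ - W⁻ = W := CFC.posPart_sub_negPart W hW
    refine ⟨diag₂ X₁ (diag₂ X₂ (diag₂ X₃ (diag₂ W⁻ W⁺))), ?_,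
      (posSemidef_simSDP_B_sub_adjoint_iff _ hρ).2 ⟨?_, hX₁₂, ?_⟩, ?_⟩
    · simp only [posSemidef_diag₂]
      exact ⟨hX₁, hX₂, hX₃, (CFC.negPart_nonneg W).posSemidef, (CFC.posPart_nonneg W).posSemidef⟩
    · exact Complex.le_def.2 ⟨htr, (Complex.le_def.1 hX₁.trace_nonneg).2.symm⟩
    · simpa only [toBlocks₁₁_diag₂, toBlocks₂₂_diag₂, hWsub] using hWX
    · simp only [trace_simSDP_A_mul, toBlocks₁₁_diag₂, toBlocks₂₂_diag₂, hWsub, Complex.sub_re]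

end StandardForm

end QSim

end

theorem mainTheorem4_general {a b ah bh a' b' : Type*}
    [Fintype a] [Fintype b] [Fintype ah] [Fintype bh] [Fintype a'] [Fintype b']
    [DecidableEq a] [DecidableEq b] [DecidableEq ah] [DecidableEq bh]
    [DecidableEq a'] [DecidableEq b']
    (N : Matrix (a × b) (a × b) ℂ →ₗ[ℂ] Matrix (a' × b') (a' × b') ℂ)
    (ρ : Matrix (ah × bh) (ah × bh) ℂ)
    (hN : QSim.IsHPTP N) (hρ : ρ.IsHermitian) (hρ₁ : ρ.trace = 1) :
    IsGLB (QSim.simPrimalValues N ρ) (QSim.errPPT N ρ) ∧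
    (QSim.simSDP N ρ).IsHermitian ∧
    (QSim.simSDP N ρ).primalValues = QSim.simPrimalValues N ρ ∧
    (QSim.simSDP N ρ).dualValues = QSim.simDualValues N ρ :=
  ⟨QSim.isGLB_simPrimalValues hN hρ hρ₁, QSim.simSDP_isHermitian hN.isHermitian_choi hρ,
    QSim.simSDP_primalValues, QSim.simSDP_dualValues hρ⟩

theorem mainTheorem4 {a b ah bh a' b' : Type*}
    [Fintype a] [Fintype b] [Fintype ah] [Fintype bh] [Fintype a'] [Fintype b']
    [DecidableEq a] [DecidableEq b] [DecidableEq ah] [DecidableEq bh]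
    [DecidableEq a'] [DecidableEq b']
    (N : Matrix (a × b) (a × b) ℂ →ₗ[ℂ] Matrix (a' × b') (a' × b') ℂ)
    (ρ : Matrix (ah × bh) (ah × bh) ℂ)
    (hN : QSim.IsChannel N) (hρ : QSim.IsState ρ) :
    -- the simulation error is the value of the primal program
    IsGLB (QSim.simPrimalValues N ρ) (QSim.errPPT N ρ) ∧
    -- the primal program in standard form, and its dual
    (QSim.simSDP N ρ).IsHermitian ∧
    (QSim.simSDP N ρ).primalValues = QSim.simPrimalValues N ρ ∧
    (QSim.simSDP N ρ).dualValues = QSim.simDualValues N ρ :=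
  mainTheorem4_general N ρ hN.isHPTP hρ.1.1 hρ.2
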